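/- Let $\mathbb K$ be $\mathbb R$ or $\mathbb C$, let $(X,\tau)$ be a bornological locally convex Hausdorff space over $\mathbb K$ and let $\mathcal B$ be the family of $\tau$-bounded sets. For a locally convex Hausdorff space $Y$ let $Y_b'$ be its strong dual. Definitions. A locally convex Hausdorff space $Y$ is *semi-Montel* if its bounded sets are relatively compact, *semi-reflexive* if the evaluation map $Y\to (Y_b')'$ is surjective, *distinguished* if $Y_b'$ is barrelled, a *Fréchet space* if it is complete and metrizable, and a *DF-space* if its family of bounded sets has a countable basis and every bounded subset of $Y_b'$ that is a countable union of equicontinuous sets is equicontinuous. A *predual* (resp. *prebidual*) of $X$ is a pair $(Y,\varphi)$ of a locally convex Hausdorff space $Y$ and a topological isomorphism $\varphi\colon X\to Y_b'$ (resp. $\varphi\colon X\to (Y_b')_b'$). For a locally convex Hausdorff topology $\widetilde\tau$ on $X$ we say that $(X,\tau)$ satisfies, for $\widetilde\tau$, - (BBC) if every $\tau$-bounded set is contained in an absolutely convex $\tau$-bounded $\widetilde\tau$-compact set; - (BBCl) if every $\tau$-bounded set is contained in an absolutely convex $\tau$-bounded $\widetilde\tau$-closed set; - (CNC) if $\tau$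 has a $0$-neighbourhood basis of absolutely convex $\widetilde\tau$-closed sets. If $\mathcal B$ has a countable basis, $\widetilde\tau\le\tau$ (i.e. $\widetilde\tau$ is coarser than $\tau$) and (BBCl) holds for $\widetilde\tau$, then $\mathcal B$ has a countable basis $(B_n)_{n\in\mathbb N}$ of non-empty absolutely convex $\widetilde\tau$-closed sets with $2B_n\subset B_{n+1}$ for all $n$, and the *mixed topology* $\gamma=\gamma(\tau,\widetilde\tau)$ is the locally convex Hausdorff topology with the $0$-neighbourhood basis $$\bigcup_{n=1}^\infty\sum_{k=1}^n (U_k\cap B_k),\qquad (U_k)_{k\in\mathbb N}\ \text{a sequence of absolutely convex } 0\text{-neighbourhoods of } (X,\widetilde\tau);$$ it does not depend on the choice of $(B_n)$. (If $(X,\tau)$ is bornological, (BBC) for $\widetilde\tau$ implies $\widetilde\tau\le\tau$ and (BBCl) for $\widetilde\tau$.) Finally, let $X'_{\mathcal B,\widetilde\tau}$ be the space of all linear functionals on $X$ whose restriction to every $B\in\mathcal B$ is $\widetilde\tau$-continuous, with the topology $\beta$ of uniform convergence on the $\tau$-bounded sets. Then the following assertions are equivalent. - (a) $(X,\tau)$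 has a Fréchet predual, i.e. a predual $(Y,\varphi)$ with $Y$ a Fréchet space. - (b) $(X,\tau)$ has a prebidual $(Y,\varphi)$ such that $Y$ is semi-Montel and $Y_b'$ is a Fréchet space. - (c) $(X,\tau)$ is a complete DF-space that satisfies (BBC) and (CNC) for some $\widetilde\tau$ such that a subset of $X$ is $\tau$-bounded if and only if it is $\gamma(\tau,\widetilde\tau)$-bounded. - (d) $(X,\tau)$ is a complete DF-space that satisfies (BBCl) and (CNC) for some $\widetilde\tau\le\tau$ such that $(X,\gamma(\tau,\widetilde\tau))$ is semi-reflexive. - (e) $(X,\tau)$ is a complete DF-space that satisfies (BBC) and (CNC) for some $\widetilde\tau$. - (f) $(X,\tau)$ is a complete DF-space that satisfies (BBC) for some $\widetilde\tau$ such that $(X'_{\mathcal B,\widetilde\tau},\beta)$ is distinguished. Moreover, whenever $(X,\tau)$ is a complete DF-space that satisfies (BBC) for $\widetilde\tau$, the space $(X'_{\mathcal B,\widetilde\tau},\beta)$ in (f) is a Fréchet space. -/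

import Mathlib

open Topology Bornology
open scoped Pointwise ComplexOrder

universe u

section LocallyConvexNotions

variable (𝕜 : Type) [RCLike 𝕜] {X : Type u} [AddCommGroup X] [Module 𝕜 X]

/-- `(X, t)` is a locally convex Hausdorff space over `𝕜`. -/
structure IsLCHS (t : TopologicalSpace X) : Prop where
  topologicalAddGroup : IsTopologicalAddGroup X
  continuousSMul : ContinuousSMul 𝕜 X
  locallyConvex : LocallyConvexSpace 𝕜 X
  t2 : T2Space X

/-- `B` is a bounded subset of `(X, t)`, i.e. it is absorbed by each neighbourhood of zero. -/
def IsBddIn (t : TopologicalSpace X) (B : Set X) : Prop :=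
  @IsVonNBounded 𝕜 X _ _ _ t B

/-- `(X, t)` is bornological: each absolutely convex set that absorbs all bounded sets is a
neighbourhood of zero. -/
def IsBornologicalTVS (t : TopologicalSpace X) : Prop :=
  ∀ U : Set X, AbsConvex 𝕜 U → (∀ B : Set X, IsBddIn 𝕜 t B → Absorbs 𝕜 U B) →
    U ∈ @nhds X t 0

/-- `(X, t)` is a complete topological (additive) group, with respect to its group uniformity. -/
def IsCompleteTVS {X : Type u} [AddCommGroup X] (t : TopologicalSpace X) : Prop :=
  ∃ _ : IsTopologicalAddGroup X, @CompleteSpace X (IsTopologicalAddGroup.rightUniformSpace X)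

/-- `(X, t)` is a Fréchet space: a complete metrizable locally convex Hausdorff space. -/
structure IsFrechet (t : TopologicalSpace X) : Prop where
  lchs : IsLCHS 𝕜 t
  metrizable : TopologicalSpace.MetrizableSpace X
  complete : IsCompleteTVS t

/-- `(X, t)` is a DF-space: it has a countable basis (fundamental sequence) of bounded sets, and
each bounded subset of the strong dual that is a countable union of equicontinuous sets is
equicontinuous. On `X →L[𝕜] 𝕜` Mathlib's topology is the topology of uniform convergence on bounded
sets, that is, the strong dual topology. -/
structure IsDF (t : TopologicalSpace X) : Prop where
  lchs : IsLCHS 𝕜 t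
  fundamental_sequence : ∃ B : ℕ → Set X, (∀ n, IsBddIn 𝕜 t (B n)) ∧
    ∀ C : Set X, IsBddIn 𝕜 t C → ∃ n, C ⊆ B n
  equicontinuous_iUnion : ∀ H : ℕ → Set (X →L[𝕜] 𝕜),
    (∀ n, Equicontinuous (fun (f : H n) (x : X) => (f : X →L[𝕜] 𝕜) x)) →
    IsVonNBounded 𝕜 (⋃ n, H n) →
    Equicontinuous (fun (f : ↥(⋃ n, H n)) (x : X) => (f : X →L[𝕜] 𝕜) x)

/-- `(X, t)` is semi-reflexive: the evaluation map from `X` to the dual of its strong dual is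
surjective. -/
def IsSemiReflexive (t : TopologicalSpace X) : Prop :=
  ∀ f : (X →L[𝕜] 𝕜) →L[𝕜] 𝕜, ∃ x : X, ∀ x' : X →L[𝕜] 𝕜, f x' = x' x

/-- `(X, t)` is semi-Montel: its bounded sets are relatively compact. -/
def IsSemiMontel (t : TopologicalSpace X) : Prop :=
  ∀ B : Set X, IsBddIn 𝕜 t B → IsCompact (closure B)

/-- `(X, t)` is distinguished: its strong dual is barrelled. -/
def IsDistinguished (t : TopologicalSpace X) : Prop :=
  BarrelledSpace 𝕜 (X →L[𝕜] 𝕜)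

/-- `(X, τ)` has a Fréchet predual: there are a Fréchet space `Y` and a topological isomorphism
from `X` onto the strong dual of `Y`. -/
def HasFrechetPredual (τ : TopologicalSpace X) : Prop :=
  ∃ (Y : Type u) (_ : AddCommGroup Y) (_ : Module 𝕜 Y) (t : TopologicalSpace Y),
    IsFrechet 𝕜 t ∧ Nonempty (X ≃L[𝕜] (Y →L[𝕜] 𝕜))

/-- `(X, τ)` has a semi-Montel prebidual with Fréchet strong dual: there are a semi-Montel locally
convex Hausdorff space `Y` whose strong dual is a Fréchet space and a topological isomorphism from
`X` onto the strong dual of the strong dual of `Y`. -/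
def HasSemiMontelPrebidualWithFrechetDual (τ : TopologicalSpace X) : Prop :=
  ∃ (Y : Type u) (_ : AddCommGroup Y) (_ : Module 𝕜 Y) (t : TopologicalSpace Y),
    IsLCHS 𝕜 t ∧ IsSemiMontel 𝕜 t ∧
    IsFrechet 𝕜 (inferInstance : TopologicalSpace (Y →L[𝕜] 𝕜)) ∧
    Nonempty (X ≃L[𝕜] ((Y →L[𝕜] 𝕜) →L[𝕜] 𝕜))

/-- (BBC) for `τ'`: each `τ`-bounded set is contained in an absolutely convex `τ`-bounded
`τ'`-compact set. -/
def BBC (τ τ' : TopologicalSpace X) : Prop :=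
  ∀ B : Set X, IsBddIn 𝕜 τ B →
    ∃ C : Set X, B ⊆ C ∧ AbsConvex 𝕜 C ∧ IsBddIn 𝕜 τ C ∧ @IsCompact X τ' C

/-- (BBCl) for `τ'`: each `τ`-bounded set is contained in an absolutely convex `τ`-bounded
`τ'`-closed set. -/
def BBCl (τ τ' : TopologicalSpace X) : Prop :=
  ∀ B : Set X, IsBddIn 𝕜 τ B →
    ∃ C : Set X, B ⊆ C ∧ AbsConvex 𝕜 C ∧ IsBddIn 𝕜 τ C ∧ IsClosed[τ'] C

/-- (CNC) for `τ'`: `τ` has a basis of neighbourhoods of zero consisting of absolutely convex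
`τ'`-closed sets. -/
def CNC (τ τ' : TopologicalSpace X) : Prop :=
  ∀ U ∈ @nhds X τ 0, ∃ V ∈ @nhds X τ 0, V ⊆ U ∧ AbsConvex 𝕜 V ∧ IsClosed[τ'] V

/-- `τ` and `γ` have the same bounded sets. -/
def SameBounded (τ γ : TopologicalSpace X) : Prop :=
  ∀ B : Set X, IsBddIn 𝕜 τ B ↔ IsBddIn 𝕜 γ B

end LocallyConvexNotions

section MixedTopology

variable (𝕜 : Type) [RCLike 𝕜] {X : Type u} [AddCommGroup X] [Module 𝕜 X]

/-- `(B n)` is a countable basis of the `τ`-bounded sets that consists of (non-empty) absolutely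
convex `τ'`-closed sets with `2 B n ⊆ B (n + 1)`. -/
structure IsMixedBasis (τ τ' : TopologicalSpace X) (B : ℕ → Set X) : Prop where
  bounded : ∀ n, IsBddIn 𝕜 τ (B n)
  basis : ∀ C : Set X, IsBddIn 𝕜 τ C → ∃ n, C ⊆ B n
  zero_mem : ∀ n, (0 : X) ∈ B n
  absConvex : ∀ n, AbsConvex 𝕜 (B n)
  closed : ∀ n, IsClosed[τ'] (B n)
  two_smul_subset : ∀ n, (2 : 𝕜) • B n ⊆ B (n + 1)

/-- `(U n)` is a sequence of absolutely convex `τ'`-neighbourhoods of zero. -/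
def IsNhdSeq (τ' : TopologicalSpace X) (U : ℕ → Set X) : Prop :=
  ∀ n, U n ∈ @nhds X τ' 0 ∧ AbsConvex 𝕜 (U n)

/-- The union over `n` of the algebraic sums `(U 0 ∩ B 0) + ⋯ + (U n ∩ B n)`. -/
def mixedNhd (B U : ℕ → Set X) : Set X :=
  ⋃ n : ℕ, ∑ k ∈ Finset.range (n + 1), (U k ∩ B k)

theorem mixedNhd_mono (B : ℕ → Set X) {U V : ℕ → Set X} (h : ∀ n, U n ⊆ V n) :
    mixedNhd B U ⊆ mixedNhd B V :=
  Set.iUnion_mono fun _ => Set.finsetSum_subset_finsetSum _ _ _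
    fun k _ => Set.inter_subset_inter_left _ (h k)

/-- The mixed topology `γ(τ, τ')`: the sets `mixedNhd B U`, where `U` runs through the sequences of
absolutely convex `τ'`-neighbourhoods of zero, are a basis of the neighbourhoods of zero. The result
does not depend on the choice of `B`, see `isOpen_mixedTopology_iff`. -/
@[reducible] def mixedTopology (τ τ' : TopologicalSpace X) : TopologicalSpace X where
  IsOpen s := ∀ B : ℕ → Set X, IsMixedBasis 𝕜 τ τ' B →
    ∀ x ∈ s, ∃ U : ℕ → Set X, IsNhdSeq 𝕜 τ' U ∧ ∀ y ∈ mixedNhd B U, x + y ∈ s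
  isOpen_univ := fun _ _ _ _ =>
    ⟨fun _ => Set.univ, fun _ => ⟨Filter.univ_mem, AbsConvex.univ⟩, fun _ _ => trivial⟩
  isOpen_inter := by
    intro s t hs ht B hB x hx
    obtain ⟨U, hU, hU'⟩ := hs B hB x hx.1
    obtain ⟨V, hV, hV'⟩ := ht B hB x hx.2
    refine ⟨fun n => U n ∩ V n,
      fun n => ⟨Filter.inter_mem (hU n).1 (hV n).1, (hU n).2.inter (hV n).2⟩, fun y hy => ?_⟩
    exact ⟨hU' y (mixedNhd_mono B (fun _ => Set.inter_subset_left) hy),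
      hV' y (mixedNhd_mono B (fun _ => Set.inter_subset_right) hy)⟩
  isOpen_sUnion := by
    intro S hS B hB x hx
    obtain ⟨s, hs, hxs⟩ := hx
    obtain ⟨U, hU, hU'⟩ := hS s hs B hB x hxs
    exact ⟨U, hU, fun y hy => ⟨s, hs, hU' y hy⟩⟩

theorem IsMixedBasis.monotone {𝕜 : Type} [RCLike 𝕜] {X : Type u} [AddCommGroup X] [Module 𝕜 X]
    {τ τ' : TopologicalSpace X} {B : ℕ → Set X} (hB : IsMixedBasis 𝕜 τ τ' B) : Monotone B := by
  refine monotone_nat_of_le_succ fun n x hx => hB.two_smul_subset n ?_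
  refine ⟨(2 : 𝕜)⁻¹ • x, (hB.absConvex n).1 _ ?_ ⟨x, hx, rfl⟩, ?_⟩
  · rw [norm_inv, RCLike.norm_ofNat]; norm_num
  · simp only
    rw [smul_smul, mul_inv_cancel₀ two_ne_zero, one_smul]

theorem isOpen_mixedTopology_iff {𝕜 : Type} [RCLike 𝕜] {X : Type u} [AddCommGroup X] [Module 𝕜 X]
    {τ τ' : TopologicalSpace X} {B : ℕ → Set X} (hB : IsMixedBasis 𝕜 τ τ' B) (s : Set X) :
    IsOpen[mixedTopology 𝕜 τ τ'] s ↔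
      ∀ x ∈ s, ∃ U : ℕ → Set X, IsNhdSeq 𝕜 τ' U ∧ ∀ y ∈ mixedNhd B U, x + y ∈ s := by
  refine ⟨fun h => h B hB, fun h C hC x hx => ?_⟩
  choose m₀ hm₀ using fun k => hB.basis (C k) (hC.bounded k)
  let m : ℕ → ℕ := fun k => ∑ i ∈ Finset.range (k + 1), (m₀ i + 1)
  have hm : StrictMono m := strictMono_nat_of_lt_succ fun k => by
    have : m (k + 1) = m k + (m₀ (k + 1) + 1) := Finset.sum_range_succ _ _
    omega
  have hCB : ∀ k, C k ⊆ B (m k) := fun k => (hm₀ k).trans (hB.monotone (by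
    have : m k = ∑ i ∈ Finset.range k, (m₀ i + 1) + (m₀ k + 1) := Finset.sum_range_succ _ _
    omega))
  obtain ⟨U, hU, hUs⟩ := h x hx
  refine ⟨fun k => U (m k), fun k => hU (m k), fun y hy => hUs y ?_⟩
  obtain ⟨n, hn⟩ := Set.mem_iUnion.1 hy
  obtain ⟨c, hc, rfl⟩ := (Set.mem_finsetSum _ _ _).1 hn
  refine Set.mem_iUnion.2 ⟨m n, (Set.mem_finsetSum _ _ _).2 ?_⟩
  classical
  refine ⟨fun j => if j ∈ (Finset.range (n + 1)).image m then c (Function.invFun m j) else 0,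
    fun {j} _ => ?_, ?_⟩
  · by_cases hj : j ∈ (Finset.range (n + 1)).image m
    · obtain ⟨k, hk, rfl⟩ := Finset.mem_image.1 hj
      have := hc hk
      simp only [hj, if_true, Function.leftInverse_invFun hm.injective k]
      exact ⟨this.1, hCB k this.2⟩
    · simp only [hj, if_false]
      exact ⟨@mem_of_mem_nhds X τ' 0 _ (hU j).1, hB.zero_mem j⟩
  · rw [← Finset.sum_subset (s₁ := (Finset.range (n + 1)).image m), Finset.sum_image]
    · refine Finset.sum_congr rfl fun k hk => ?_
      rw [if_pos (Finset.mem_image_of_mem m hk), Function.leftInverse_invFun hm.injective k]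
    · exact fun _ _ _ _ h => hm.injective h
    · intro j hj
      obtain ⟨k, hk, rfl⟩ := Finset.mem_image.1 hj
      have := hm.monotone (Nat.lt_succ_iff.1 (Finset.mem_range.1 hk))
      exact Finset.mem_range.2 (Nat.lt_succ_iff.2 this)
    · intro j _ hj
      rw [if_neg hj]

end MixedTopology

section CandidatePredual

variable (𝕜 : Type) [RCLike 𝕜] {X : Type u} [AddCommGroup X] [Module 𝕜 X]

/-- The space of all linear functionals on `X` whose restrictions to the `τ`-bounded sets are
`τ'`-continuous. -/
def candidatePredual (τ τ' : TopologicalSpace X) : Submodule 𝕜 (X →ₗ[𝕜] 𝕜) where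
  carrier := {f | ∀ B : Set X, IsBddIn 𝕜 τ B → @ContinuousOn X 𝕜 τ' _ f B}
  add_mem' hf hg B hB := by let := τ'; exact (hf B hB).add (hg B hB)
  zero_mem' _ _ := @continuousOn_const X 𝕜 τ' _ _ _
  smul_mem' c _ hf B hB := by let := τ'; exact (hf B hB).const_smul c

/-- The topology `β` on `candidatePredual 𝕜 τ τ'` of uniform convergence on the `τ`-bounded sets. -/
@[reducible] def candidateTopology (τ τ' : TopologicalSpace X) :
    TopologicalSpace (candidatePredual 𝕜 τ τ') :=
  TopologicalSpace.induced
    (fun f => UniformOnFun.ofFun {B : Set X | IsBddIn 𝕜 τ B} (fun x => (f : X →ₗ[𝕜] 𝕜) x))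
    inferInstance

end CandidatePredual

/-! Let V be the space of linear functionals that are `τ'`-continuous on the `τ`-bounded sets, with
the topology of uniform convergence on those sets. It is the natural predual, and the question is
when the evaluation map from X to the strong dual of V is a topological isomorphism. V is Fréchet
because the bounded sets have a countable basis and uniform limits preserve continuity on them
(`IsCandidatePairing.isFrechet`). Evaluation is injective by Hahn-Banach for `τ'`, continuous
because X is bornological, and surjective under (BBC) by compactness (`eval_surjective`). Openness
needs more: either (CNC), through bipolars (`exists_nhds_preimage_eval_subset`), or barrelledness of
the strong dual of V (`exists_nhds_preimage_eval_subset_of_barrelled`). Conversely, if evaluation is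
an isomorphism, that strong dual is barrelled (`barrelledSpace_strongDual`).

The mixed topology exhibits V as a strong dual: its continuous functionals are exactly the elements
of V (`continuous_mixedTopology_iff`), and under (CNC) its bounded sets are the `τ`-bounded ones
(`sameBounded_mixedTopology`). Semi-reflexivity is then surjectivity of evaluation, and (BBC) makes
the mixed topology semi-Montel, so that X with this topology is a prebidual.

Conversely, for a Fréchet predual the weak-star topology satisfies (BBC) by Banach-Steinhaus and
Alaoglu, and (CNC) because polars are weak-star closed. -/

section Auxiliary

/-! ### Absolutely convex sets, separation, and polars in the strong dual. -/

variable {𝕜 : Type} [RCLike 𝕜] {E F : Type*} [AddCommGroup E] [Module 𝕜 E]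
  [AddCommGroup F] [Module 𝕜 F]

theorem AbsConvex.zero_mem {U : Set E} (hU : AbsConvex 𝕜 U) (hne : U.Nonempty) : (0 : E) ∈ U :=
  hU.1.zero_mem hne

theorem AbsConvex.preimage_linearMap {U : Set F} (hU : AbsConvex 𝕜 U) (f : E →ₗ[𝕜] F) :
    AbsConvex 𝕜 (f ⁻¹' U) := by
  refine ⟨?_, hU.2.linear_preimage f⟩
  rintro c hc _ ⟨x, hx, rfl⟩
  simpa using hU.1 c hc (Set.smul_mem_smul_set hx)

theorem AbsConvex.image_linearMap {U : Set E} (hU : AbsConvex 𝕜 U) (f : E →ₗ[𝕜] F) :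
    AbsConvex 𝕜 (f '' U) := by
  refine ⟨?_, hU.2.linear_image f⟩
  rintro c hc _ ⟨_, ⟨x, hx, rfl⟩, rfl⟩
  exact ⟨c • x, hU.1 c hc (Set.smul_mem_smul_set hx), by simp⟩

theorem AbsConvex.smul_set {U : Set E} (hU : AbsConvex 𝕜 U) (c : 𝕜) : AbsConvex 𝕜 (c • U) := by
  exact hU.image_linearMap (LinearMap.lsmul 𝕜 E c)

theorem AbsConvex.add_sets {U V : Set E} (hU : AbsConvex 𝕜 U) (hV : AbsConvex 𝕜 V) :
    AbsConvex 𝕜 (U + V) := ⟨hU.1.add hV.1, hU.2.add hV.2⟩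

theorem absConvex_zero : AbsConvex 𝕜 (0 : Set E) := ⟨balanced_zero, convex_singleton 0⟩

theorem absConvex_finsetSum {ι : Type*} (s : Finset ι) {U : ι → Set E}
    (hU : ∀ i ∈ s, AbsConvex 𝕜 (U i)) : AbsConvex 𝕜 (∑ i ∈ s, U i) := by
  classical
  induction s using Finset.induction_on with
  | empty => simpa using absConvex_zero
  | insert i s hi ih =>
    rw [Finset.sum_insert hi]
    exact (hU i (by simp)).add_sets (ih fun j hj => hU j (by simp [hj]))

theorem absConvex_norm_le_one : AbsConvex 𝕜 {z : 𝕜 | ‖z‖ ≤ 1} := by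
  have h : {z : 𝕜 | ‖z‖ ≤ 1} = Metric.closedBall 0 1 := by ext; simp
  rw [h]
  exact ⟨balanced_closedBall_zero, convex_RCLike_iff_convex_real.2 (convex_closedBall 0 1)⟩

theorem absConvex_polar {ι : Type*} (s : Set ι) (f : ι → E →ₗ[𝕜] 𝕜) :
    AbsConvex 𝕜 {x | ∀ i ∈ s, ‖f i x‖ ≤ 1} := by
  have h : {x | ∀ i ∈ s, ‖f i x‖ ≤ 1} = ⋂ (i) (_ : i ∈ s), f i ⁻¹' {z : 𝕜 | ‖z‖ ≤ 1} := by
    ext; simp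
  rw [h]
  exact AbsConvex.iInter₂ fun i _ => absConvex_norm_le_one.preimage_linearMap (f i)

theorem AbsConvex.smul_mem_of_norm_le {U : Set E} (hU : AbsConvex 𝕜 U) {c : 𝕜} (hc : ‖c‖ ≤ 1)
    {x : E} (hx : x ∈ U) : c • x ∈ U :=
  hU.1 c hc (Set.smul_mem_smul_set hx)

theorem AbsConvex.sub_mem_two_smul {U : Set E} (hU : AbsConvex 𝕜 U) {x y : E} (hx : x ∈ U)
    (hy : y ∈ U) : x - y ∈ (2 : 𝕜) • U := by
  refine ⟨(2 : 𝕜)⁻¹ • x + (2 : 𝕜)⁻¹ • (-y), ?_, ?_⟩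
  · have h : (0 : 𝕜) ≤ 2⁻¹ := inv_nonneg.2 zero_le_two
    refine hU.2 hx ?_ h h (by norm_num)
    simpa using hU.smul_mem_of_norm_le (c := -1) (by simp) hy
  · simp [smul_smul, sub_eq_add_neg]

/-- For a balanced set one positive real scale controls all larger scalars, so absorption arguments
can carry a single constant. -/
theorem absorbs_iff_exists_real {U B : Set E} (hU : Balanced 𝕜 U) :
    Absorbs 𝕜 U B ↔ ∃ r : ℝ, 0 < r ∧ ∀ x ∈ B, (r : 𝕜) • x ∈ U := by
  constructor
  · intro h
    obtain ⟨r, hr, h⟩ := h.exists_pos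
    refine ⟨r⁻¹, by positivity, fun x hx => ?_⟩
    have hr0 : (r : 𝕜) ≠ 0 := by exact_mod_cast hr.ne'
    obtain ⟨y, hy, rfl⟩ := h (r : 𝕜) (by simp [abs_of_pos hr]) hx
    simpa [smul_smul, hr0] using hy
  · rintro ⟨r, hr, h⟩
    refine Absorbs.of_norm ⟨r⁻¹, fun c hc x hx => ?_⟩
    have hc0 : 0 < ‖c‖ := lt_of_lt_of_le (by positivity) hc
    have hc1 : c ≠ 0 := norm_pos_iff.1 hc0
    have hr0 : (r : 𝕜) ≠ 0 := by exact_mod_cast hr.ne'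
    refine ⟨c⁻¹ • x, ?_, by simp [smul_smul, hc1]⟩
    have := hU (c⁻¹ * (r : 𝕜)⁻¹) (by
      rw [norm_mul, norm_inv, norm_inv, RCLike.norm_ofReal, abs_of_pos hr]
      rw [← div_eq_inv_mul]
      exact (div_le_one hc0).2 hc) (Set.smul_mem_smul_set (h x hx))
    simpa [smul_smul, mul_assoc, hr0] using this

theorem exists_norm_le_of_polar {B : Set E} {f : E →ₗ[𝕜] 𝕜} {r : ℝ} (hr : 0 < r)
    (h : ∀ x ∈ B, ‖f ((r : 𝕜) • x)‖ ≤ 1) : ∀ x ∈ B, ‖f x‖ ≤ r⁻¹ := by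
  intro x hx
  have := h x hx
  rw [map_smul, norm_smul, RCLike.norm_ofReal, abs_of_pos hr] at this
  rw [← one_div, le_div_iff₀ hr, mul_comm]
  exact this

instance RCLike.locallyConvexSpace_self : LocallyConvexSpace 𝕜 𝕜 :=
  LocallyConvexSpace.ofBasisZero 𝕜 𝕜 (fun r : ℝ => Metric.closedBall 0 r) (fun r => 0 < r)
    Metric.nhds_basis_closedBall
    fun _ _ => convex_RCLike_iff_convex_real.2 (convex_closedBall 0 _)

variable [TopologicalSpace E]

theorem exists_real_smul_mem_of_isVonNBounded {U B : Set E} (hB : IsVonNBounded 𝕜 B)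
    (hU : U ∈ 𝓝 (0 : E)) (hUb : Balanced 𝕜 U) : ∃ r : ℝ, 0 < r ∧ ∀ x ∈ B, (r : 𝕜) • x ∈ U :=
  (absorbs_iff_exists_real hUb).1 (hB hU)

/-- A closed absolutely convex set and a point outside of it are separated by a functional that is
bounded by `1` on the set. -/
theorem exists_dual_norm_le_one_of_notMem [IsTopologicalAddGroup E] [ContinuousSMul 𝕜 E]
    [LocallyConvexSpace 𝕜 E] {U : Set E} (hU : AbsConvex 𝕜 U) (hcl : IsClosed U)
    (hne : U.Nonempty) {x : E} (hx : x ∉ U) :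
    ∃ f : E →L[𝕜] 𝕜, (∀ y ∈ U, ‖f y‖ ≤ 1) ∧ 1 < ‖f x‖ := by
  -- Separation takes place over the reals; convexity over `𝕜` with the complex order only involves
  -- real coefficients, so local convexity transfers.
  let : Module ℝ E := Module.compHom E (algebraMap ℝ 𝕜)
  have : IsScalarTower ℝ 𝕜 E := ⟨fun r c x => by
    change (r • c) • x = algebraMap ℝ 𝕜 r • c • x
    rw [smul_smul, Algebra.smul_def]⟩
  have : LocallyConvexSpace ℝ E := ⟨fun x =>
    (LocallyConvexSpace.convex_basis (𝕜 := 𝕜) x).congr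
      (fun s => by rw [convex_RCLike_iff_convex_real]) (fun _ _ => rfl)⟩
  obtain ⟨f, u, hfu, hux⟩ := RCLike.geometric_hahn_banach_closed_point (𝕜 := 𝕜)
    (convex_RCLike_iff_convex_real.1 hU.2) hcl hx
  have hu : 0 < u := by simpa using hfu 0 (hU.zero_mem hne)
  have hu0 : ‖(u : 𝕜)⁻¹‖ = u⁻¹ := by rw [norm_inv, RCLike.norm_ofReal, abs_of_pos hu]
  refine ⟨(u : 𝕜)⁻¹ • f, fun y hy => ?_, ?_⟩
  · obtain ⟨c, hc, hcf⟩ := RCLike.exists_norm_eq_mul_self (f y)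
    have h := hfu (c • y) (hU.smul_mem_of_norm_le hc.le hy)
    rw [map_smul, smul_eq_mul, ← hcf, RCLike.ofReal_re] at h
    rw [smul_apply, norm_smul, hu0, ← div_eq_inv_mul]
    exact (div_le_one hu).2 h.le
  · rw [smul_apply, norm_smul, hu0, ← div_eq_inv_mul]
    exact (one_lt_div hu).2 (hux.trans_le (RCLike.re_le_norm _))

/-- The radius is absorbed by rescaling the bounded set, so unit polars suffice. -/
theorem strongDual_hasBasis [ContinuousConstSMul 𝕜 E] :
    (𝓝 (0 : E →L[𝕜] 𝕜)).HasBasis (fun S : Set E => IsVonNBounded 𝕜 S)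
      (fun S => {f | ∀ x ∈ S, ‖f x‖ ≤ 1}) := by
  refine (ContinuousLinearMap.hasBasis_nhds_zero_of_basis
    (Metric.nhds_basis_closedBall (x := (0 : 𝕜)))).to_hasBasis ?_ ?_
  · rintro ⟨S, ε⟩ ⟨hS, hε : 0 < ε⟩
    have hε0 : (ε : 𝕜) ≠ 0 := by exact_mod_cast hε.ne'
    refine ⟨(ε : 𝕜)⁻¹ • S, hS.image ((ε : 𝕜)⁻¹ • ContinuousLinearMap.id 𝕜 E),
      fun f hf x hx => ?_⟩
    · have := hf _ (Set.smul_mem_smul_set hx)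
      rw [map_smul, norm_smul, norm_inv, RCLike.norm_ofReal, abs_of_pos hε,
        ← div_eq_inv_mul, div_le_one hε] at this
      simpa using this
  · exact fun S hS => ⟨(S, 1), ⟨hS, one_pos⟩, fun f hf x hx => by simpa using hf x hx⟩

theorem isVonNBounded_strongDual_iff {H : Set (E →L[𝕜] 𝕜)} :
    IsVonNBounded 𝕜 H ↔
      ∀ S : Set E, IsVonNBounded 𝕜 S → ∃ C : ℝ, ∀ f ∈ H, ∀ x ∈ S, ‖f x‖ ≤ C := by
  rw [ContinuousLinearMap.isVonNBounded_iff]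
  refine forall₂_congr fun S _ => ?_
  rw [NormedSpace.isVonNBounded_iff']
  simp only [Set.forall_mem_image2]

/-- A linear functional that is dominated by the polar of an absolutely convex compact set `K` is
the evaluation at some point of `K`. -/
theorem exists_mem_eval_eq_of_isCompact {W : Type*} [AddCommGroup W] [Module 𝕜 W]
    (p : W →ₗ[𝕜] E →ₗ[𝕜] 𝕜) {K : Set E} (hK : AbsConvex 𝕜 K) (hne : K.Nonempty)
    (hKc : IsCompact K) (hp : ∀ w, ContinuousOn (p w) K) (φ : W →ₗ[𝕜] 𝕜)
    (hφ : ∀ w, (∀ x ∈ K, ‖p w x‖ ≤ 1) → ‖φ w‖ ≤ 1) :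
    ∃ x ∈ K, ∀ w, φ w = p w x := by
  classical
  have : CompactSpace K := isCompact_iff_compactSpace.1 hKc
  -- For finitely many w the problem lives in `s → 𝕜`, where the image of K is compact and
  -- absolutely convex. A functional separating z from it is a linear combination of coordinates,
  -- hence comes from one element of W, which would violate `hφ`. Compactness of K then treats all w
  -- at once.
  have key : ∀ s : Finset W, (⋂ w ∈ s, {x : K | φ w = p w x}).Nonempty := by
    intro s
    let T : E →ₗ[𝕜] (s → 𝕜) := LinearMap.pi fun w => p w
    let z : s → 𝕜 := fun w => φ w
    have hTc : IsCompact (T '' K) :=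
      hKc.image_of_continuousOn (continuousOn_pi.2 fun w => hp w)
    have hz : z ∈ T '' K := by
      by_contra hz
      obtain ⟨f, hf, hfz⟩ := exists_dual_norm_le_one_of_notMem (hK.image_linearMap T)
        hTc.isClosed (hne.image T) hz
      have hfs : ∀ y : s → 𝕜, f y = ∑ i, y i • f (fun j => if i = j then 1 else 0) :=
        fun y => LinearMap.pi_apply_eq_sum_univ f.toLinearMap y
      let w : W := ∑ i : s, f (fun j => if i = j then 1 else 0) • (i : W)
      have h1 : ∀ x, p w x = f (T x) := fun x => by
        rw [hfs]
        simp [w, T, LinearMap.sum_apply, mul_comm]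
      have h2 : φ w = f z := by
        rw [hfs]
        simp [w, z, mul_comm]
      refine hfz.not_ge ?_
      rw [← h2]
      exact hφ w fun x hx => (h1 x).symm ▸ hf _ ⟨x, hx, rfl⟩
    obtain ⟨x, hx, hxz⟩ := hz
    refine ⟨⟨x, hx⟩, ?_⟩
    simp only [Set.mem_iInter, Set.mem_ofPred_eq]
    exact fun w hw => (congrFun hxz ⟨w, hw⟩).symm
  obtain ⟨x, hx⟩ := CompactSpace.iInter_nonempty (t := fun w : W => {x : K | φ w = p w x})
    (fun w => isClosed_eq continuous_const (continuousOn_iff_continuous_domRestrict.1 (hp w))) key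
  exact ⟨x, x.2, fun w => Set.mem_iInter.1 hx w⟩

/-- A linear bijection that is continuous and open at zero is a topological isomorphism. -/
theorem exists_continuousLinearEquiv_of_bijective [IsTopologicalAddGroup E]
    [TopologicalSpace F] [IsTopologicalAddGroup F] (f : E →ₗ[𝕜] F) (hf : Function.Bijective f)
    (hc : Continuous f) (ho : ∀ U ∈ 𝓝 (0 : E), ∃ N ∈ 𝓝 (0 : F), f ⁻¹' N ⊆ U) :
    ∃ e : E ≃L[𝕜] F, ∀ x, e x = f x := by
  let e := LinearEquiv.ofBijective f hf
  refine ⟨⟨e, hc, ?_⟩, fun _ => rfl⟩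
  refine continuous_of_continuousAt_zero e.symm.toLinearMap ?_
  intro U hU
  have hU' : U ∈ 𝓝 (0 : E) := by simpa using hU
  obtain ⟨N, hN, hNU⟩ := ho U hU'
  refine Filter.mem_map.2 (Filter.mem_of_superset hN fun y hy => hNU ?_)
  have : f (e.symm y) = y := e.apply_symm_apply y
  simpa [this] using hy

end Auxiliary

/-! ### Bounded sets and the existence of mixed bases. -/

section BoundedSets

variable {𝕜 : Type} [RCLike 𝕜] {X : Type u} [AddCommGroup X] [Module 𝕜 X]
  {τ τ' : TopologicalSpace X}

theorem IsLCHS.isBddIn_singleton (hτ : IsLCHS 𝕜 τ) (x : X) : IsBddIn 𝕜 τ {x} := by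
  have := hτ.continuousSMul
  exact isVonNBounded_singleton x

theorem IsLCHS.isBddIn_insert (hτ : IsLCHS 𝕜 τ) (x : X) {B : Set X} (hB : IsBddIn 𝕜 τ B) :
    IsBddIn 𝕜 τ (insert x B) := by
  have := hτ.continuousSMul
  exact (isVonNBounded_insert x).2 hB

theorem IsLCHS.isBddIn_smul (hτ : IsLCHS 𝕜 τ) (c : 𝕜) {B : Set X} (hB : IsBddIn 𝕜 τ B) :
    IsBddIn 𝕜 τ (c • B) := by
  have := hτ.continuousSMul
  exact IsVonNBounded.image hB (c • ContinuousLinearMap.id 𝕜 X)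

theorem isBddIn_empty : IsBddIn 𝕜 τ ∅ :=
  isVonNBounded_empty 𝕜 X

theorem IsBddIn.mono {B C : Set X} (hC : IsBddIn 𝕜 τ C) (h : B ⊆ C) : IsBddIn 𝕜 τ B :=
  IsVonNBounded.subset h hC

theorem IsBddIn.union {B C : Set X} (hB : IsBddIn 𝕜 τ B) (hC : IsBddIn 𝕜 τ C) :
    IsBddIn 𝕜 τ (B ∪ C) :=
  IsVonNBounded.union hB hC

theorem IsLCHS.exists_absConvex_nhds_subset (hτ : IsLCHS 𝕜 τ) {U : Set X} (hU : U ∈ @nhds X τ 0) :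
    ∃ V ∈ @nhds X τ 0, AbsConvex 𝕜 V ∧ V ⊆ U := by
  have := hτ.continuousSMul
  have := hτ.locallyConvex
  obtain ⟨V, hV, hVU⟩ := (nhds_hasBasis_absConvex 𝕜 X).mem_iff.1 hU
  exact ⟨V, hV.1, hV.2, hVU⟩

theorem IsLCHS.smul_mem_nhds (hτ : IsLCHS 𝕜 τ) {U : Set X} (hU : U ∈ @nhds X τ 0) {c : 𝕜}
    (hc : c ≠ 0) : c • U ∈ @nhds X τ 0 := by
  have := hτ.continuousSMul
  exact (set_smul_mem_nhds_zero_iff hc).2 hU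

theorem IsLCHS.isBddIn_of_isCompact (hτ : IsLCHS 𝕜 τ) {K : Set X} (hK : @IsCompact X τ K) :
    IsBddIn 𝕜 τ K := by
  have := hτ.continuousSMul
  have := hτ.topologicalAddGroup
  exact IsCompact.isVonNBounded 𝕜 hK

theorem le_of_nhds_zero_le (hτ : @IsTopologicalAddGroup X τ _) (hτ' : IsLCHS 𝕜 τ')
    (h : ∀ U ∈ @nhds X τ' 0, AbsConvex 𝕜 U → U ∈ @nhds X τ 0) : τ ≤ τ' := by
  have h0 : @nhds X τ 0 ≤ @nhds X τ' 0 := fun U hU => by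
    obtain ⟨V, hV, hVa, hVU⟩ := hτ'.exists_absConvex_nhds_subset hU
    exact Filter.mem_of_superset (h V hV hVa) hVU
  rw [← continuous_id_iff_le]
  exact @continuous_of_continuousAt_zero X τ _ hτ X (X →+ X) _ τ'
    hτ'.topologicalAddGroup.toContinuousAdd _ _ (AddMonoidHom.id X) h0

theorem BBC.toBBCl (hτ' : IsLCHS 𝕜 τ') (h : BBC 𝕜 τ τ') : BBCl 𝕜 τ τ' := by
  have := hτ'.t2
  intro B hB
  obtain ⟨C, hBC, hC, hCb, hCc⟩ := h B hB
  exact ⟨C, hBC, hC, hCb, IsCompact.isClosed hCc⟩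

/-- On a bornological space each topology that makes the bounded sets relatively compact is
coarser than the given one. -/
theorem BBC.le (hτ : IsLCHS 𝕜 τ) (hborn : IsBornologicalTVS 𝕜 τ) (hτ' : IsLCHS 𝕜 τ')
    (h : BBC 𝕜 τ τ') : τ ≤ τ' := by
  refine le_of_nhds_zero_le hτ.topologicalAddGroup hτ' fun U hU hUa => hborn U hUa fun B hB => ?_
  obtain ⟨C, hBC, -, -, hC⟩ := h B hB
  exact ((hτ'.isBddIn_of_isCompact hC).mono hBC) hU

/-- A countable basis of the bounded sets can be replaced by an increasing one that consists of
members of a cofinal family of absolutely convex bounded sets. -/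
theorem exists_mixedBasis_of_cofinal (hτ : IsLCHS 𝕜 τ) {D : ℕ → Set X}
    (hD : ∀ n, IsBddIn 𝕜 τ (D n)) (hDb : ∀ C : Set X, IsBddIn 𝕜 τ C → ∃ n, C ⊆ D n)
    {P : Set X → Prop} (hP : ∀ B : Set X, IsBddIn 𝕜 τ B →
      ∃ C : Set X, B ⊆ C ∧ AbsConvex 𝕜 C ∧ IsBddIn 𝕜 τ C ∧ P C) (hPc : ∀ C, P C → IsClosed[τ'] C) :
    ∃ B : ℕ → Set X, IsMixedBasis 𝕜 τ τ' B ∧ ∀ n, P (B n) := by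
  choose! f hfs hfa hfb hfP using hP
  -- Each ingredient secures one requirement: 0 for `zero_mem`, D n for cofinality, and the doubled
  -- predecessor for `two_smul_subset`.
  let g : ℕ → Set X → Set X := fun n S => insert 0 (D n) ∪ (2 : 𝕜) • S
  have hg : ∀ n S, IsBddIn 𝕜 τ S → IsBddIn 𝕜 τ (g n S) := fun n S hS =>
    (hτ.isBddIn_insert 0 (hD n)).union (hτ.isBddIn_smul 2 hS)
  let B : ℕ → Set X := fun n => Nat.rec (f (g 0 ∅)) (fun n S => f (g (n + 1) S)) n
  have hB : ∀ n, ∃ S, IsBddIn 𝕜 τ S ∧ B n = f (g n S) := by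
    intro n
    induction n with
    | zero => exact ⟨∅, isBddIn_empty, rfl⟩
    | succ n ih =>
      obtain ⟨S, hS, hBS⟩ := ih
      exact ⟨B n, hBS ▸ hfb _ (hg n S hS), rfl⟩
  have hbd : ∀ n, IsBddIn 𝕜 τ (B n) := fun n => by
    obtain ⟨S, hS, h⟩ := hB n
    exact h ▸ hfb _ (hg n S hS)
  have hgB : ∀ n, insert 0 (D n) ⊆ B n := fun n => by
    obtain ⟨S, hS, h⟩ := hB n
    exact h ▸ Set.subset_union_left.trans (hfs _ (hg n S hS))
  have hPB : ∀ n, P (B n) := fun n => by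
    obtain ⟨S, hS, h⟩ := hB n
    exact h ▸ hfP _ (hg n S hS)
  refine ⟨B, ⟨hbd, fun C hC => ?_, fun n => hgB n (Set.mem_insert _ _), fun n => ?_,
    fun n => hPc _ (hPB n), fun n => ?_⟩, hPB⟩
  · obtain ⟨n, hn⟩ := hDb C hC
    exact ⟨n, hn.trans ((Set.subset_insert _ _).trans (hgB n))⟩
  · obtain ⟨S, hS, h⟩ := hB n
    exact h ▸ hfa _ (hg n S hS)
  · exact Set.subset_union_right.trans (hfs _ (hg (n + 1) (B n) (hbd n)))

theorem exists_mixedBasis (hDF : IsDF 𝕜 τ) (h : BBCl 𝕜 τ τ') :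
    ∃ B : ℕ → Set X, IsMixedBasis 𝕜 τ τ' B := by
  obtain ⟨D, hD, hDb⟩ := hDF.fundamental_sequence
  obtain ⟨B, hB, -⟩ := exists_mixedBasis_of_cofinal hDF.lchs hD hDb h (fun _ hC => hC)
  exact ⟨B, hB⟩

theorem exists_mixedBasis_isCompact (hDF : IsDF 𝕜 τ) (hτ' : IsLCHS 𝕜 τ') (h : BBC 𝕜 τ τ') :
    ∃ B : ℕ → Set X, IsMixedBasis 𝕜 τ τ' B ∧ ∀ n, @IsCompact X τ' (B n) := by
  have := hτ'.t2
  obtain ⟨D, hD, hDb⟩ := hDF.fundamental_sequence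
  exact exists_mixedBasis_of_cofinal hDF.lchs hD hDb h (fun _ hC => IsCompact.isClosed hC)

theorem IsLCHS.exists_dual_norm_le_one (hτ : IsLCHS 𝕜 τ) {U : Set X} (hU : AbsConvex 𝕜 U)
    (hcl : IsClosed[τ] U) (hne : U.Nonempty) {x : X} (hx : x ∉ U) :
    ∃ f : X →ₗ[𝕜] 𝕜, @Continuous X 𝕜 τ _ f ∧ (∀ y ∈ U, ‖f y‖ ≤ 1) ∧ 1 < ‖f x‖ := by
  have := hτ.topologicalAddGroup
  have := hτ.continuousSMul
  have := hτ.locallyConvex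
  obtain ⟨f, hf, hfx⟩ := exists_dual_norm_le_one_of_notMem hU hcl hne hx
  exact ⟨f, f.continuous, hf, hfx⟩

end BoundedSets

/-! ### The candidate predual as an abstract pairing, and its evaluation map. -/

section CandidatePairing

variable {𝕜 : Type} [RCLike 𝕜] {X : Type u} [AddCommGroup X] [Module 𝕜 X]
  {V : Type u} [AddCommGroup V] [Module 𝕜 V]

theorem absConvex_pairing_polar (p : V →ₗ[𝕜] X →ₗ[𝕜] 𝕜) (B : Set X) :
    AbsConvex 𝕜 {v : V | ∀ x ∈ B, ‖p v x‖ ≤ 1} :=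
  absConvex_polar B p.flip

variable [tV : TopologicalSpace V]

/-- The pairing `p` identifies `V` with the space of all linear functionals on `X` whose
restrictions to the `τ`-bounded sets are `τ'`-continuous, with the topology of uniform convergence
on the `τ`-bounded sets. -/
structure IsCandidatePairing (τ τ' : TopologicalSpace X) (p : V →ₗ[𝕜] X →ₗ[𝕜] 𝕜) : Prop where
  injective : Function.Injective p
  continuousOn : ∀ v, ∀ B : Set X, IsBddIn 𝕜 τ B → @ContinuousOn X 𝕜 τ' _ (p v) B
  exists_eq : ∀ f : X →ₗ[𝕜] 𝕜, (∀ B : Set X, IsBddIn 𝕜 τ B → @ContinuousOn X 𝕜 τ' _ f B) →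
    ∃ v, p v = f
  isInducing : IsInducing fun v => UniformOnFun.ofFun {B : Set X | IsBddIn 𝕜 τ B} (p v)

variable {τ' τ : TopologicalSpace X} {p : V →ₗ[𝕜] X →ₗ[𝕜] 𝕜}

namespace IsCandidatePairing

variable (hp : IsCandidatePairing τ τ' p)

include hp

theorem isTopologicalAddGroup : IsTopologicalAddGroup V := by
  let φ : V →+ UniformOnFun X 𝕜 {B : Set X | IsBddIn 𝕜 τ B} :=
    { toFun := fun v => UniformOnFun.ofFun _ (p v)
      map_zero' := by rw [map_zero]; rfl
      map_add' := fun v w => by rw [map_add]; rfl }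
  exact IsInducing.topologicalAddGroup φ hp.isInducing

theorem hasBasis (hτ : IsLCHS 𝕜 τ) :
    (𝓝 (0 : V)).HasBasis (fun B : Set X => IsBddIn 𝕜 τ B)
      (fun B => {v | ∀ x ∈ B, ‖p v x‖ ≤ 1}) := by
  have hne : {B : Set X | IsBddIn 𝕜 τ B}.Nonempty := ⟨∅, isBddIn_empty⟩
  have hdir : DirectedOn (· ⊆ ·) {B : Set X | IsBddIn 𝕜 τ B} :=
    directedOn_of_sup_mem fun _ _ => IsBddIn.union
  have h := (UniformOnFun.hasBasis_nhds_zero_of_basis _ hne hdir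
    (Metric.nhds_basis_closedBall (x := (0 : 𝕜)))).comap
      (fun v => UniformOnFun.ofFun {B : Set X | IsBddIn 𝕜 τ B} (p v))
  have h0 : 𝓝 (0 : V) = (𝓝 (0 : UniformOnFun X 𝕜 {B : Set X | IsBddIn 𝕜 τ B})).comap
      (fun v => UniformOnFun.ofFun {B : Set X | IsBddIn 𝕜 τ B} (p v)) := by
    rw [hp.isInducing.nhds_eq_comap, map_zero]
    rfl
  rw [h0]
  refine h.to_hasBasis ?_ ?_
  · rintro ⟨S, ε⟩ ⟨hS, hε : 0 < ε⟩
    refine ⟨(ε : 𝕜)⁻¹ • S, hτ.isBddIn_smul _ hS, fun v hv => ?_⟩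
    rw [Set.mem_ofPred_eq] at hv
    rw [Set.mem_preimage, Set.mem_ofPred_eq]
    intro x hx
    have := hv _ (Set.smul_mem_smul_set hx)
    rw [map_smul, norm_smul, norm_inv, RCLike.norm_ofReal, abs_of_pos hε,
      ← div_eq_inv_mul, div_le_one hε] at this
    exact mem_closedBall_zero_iff.2 this
  · intro S hS
    refine ⟨(S, 1), ⟨hS, one_pos⟩, fun v hv => ?_⟩
    rw [Set.mem_ofPred_eq]
    intro x hx
    exact mem_closedBall_zero_iff.1 (hv x hx)

/-- The functionals in the candidate predual are bounded on the bounded sets. -/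
theorem exists_norm_le (hτ : IsLCHS 𝕜 τ) (hle : τ ≤ τ') (h : BBCl 𝕜 τ τ')
    (hτ' : IsLCHS 𝕜 τ') (v : V) {B : Set X} (hB : IsBddIn 𝕜 τ B) :
    ∃ C : ℝ, ∀ x ∈ B, ‖p v x‖ ≤ C := by
  obtain ⟨C, hBC, hCa, hCb, -⟩ := h _ (hτ.isBddIn_insert 0 hB)
  have h0 : (0 : X) ∈ C := hBC (Set.mem_insert _ _)
  have hc := hp.continuousOn v C hCb 0 h0
  have h1 : {z : 𝕜 | ‖z‖ ≤ 1} ∈ 𝓝 (p v 0) := by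
    rw [map_zero]
    filter_upwards [Metric.closedBall_mem_nhds (0 : 𝕜) one_pos] with z hz
    simpa using hz
  obtain ⟨U, hU, hUC⟩ :=
    (@mem_nhdsWithin_iff_exists_mem_nhds_inter X τ' _ _ _).1 (hc h1)
  obtain ⟨W, hW, hWa, hWU⟩ := hτ'.exists_absConvex_nhds_subset hU
  have hWτ : W ∈ @nhds X τ 0 := nhds_mono hle hW
  obtain ⟨r, hr, hrW⟩ := (absorbs_iff_exists_real hWa.1).1 (hCb hWτ)
  -- Continuity at 0 is only known relative to C, so the scale must carry C into W and also into C
  -- itself.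
  let s := min r 1
  have hs : 0 < s := lt_min hr one_pos
  have hsW : ∀ x ∈ C, (s : 𝕜) • x ∈ W := fun x hx => by
    have := hWa.smul_mem_of_norm_le (c := ((s / r : ℝ) : 𝕜)) (by
      rw [RCLike.norm_ofReal, abs_of_pos (by positivity)]
      exact (div_le_one hr).2 (min_le_left _ _)) (hrW x hx)
    rwa [smul_smul, ← RCLike.ofReal_mul, div_mul_cancel₀ _ hr.ne'] at this
  have hsC : ∀ x ∈ C, (s : 𝕜) • x ∈ C := fun x hx => hCa.smul_mem_of_norm_le (by
    rw [RCLike.norm_ofReal, abs_of_pos hs]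
    exact min_le_right _ _) hx
  refine ⟨s⁻¹, fun x hx => exists_norm_le_of_polar hs (fun y hy => ?_) x
    (hBC (Set.mem_insert_of_mem _ hx))⟩
  exact hUC ⟨hWU (hsW y hy), hsC y hy⟩

theorem isVonNBounded (hτ : IsLCHS 𝕜 τ) {S : Set (V)}
    (h : ∀ B : Set X, IsBddIn 𝕜 τ B → ∃ C : ℝ, ∀ v ∈ S, ∀ x ∈ B, ‖p v x‖ ≤ C) :
    IsVonNBounded 𝕜 S := by
  rw [(hp.hasBasis hτ).isVonNBounded_iff]
  intro B hB
  obtain ⟨C, hC⟩ := h B hB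
  have hbal := (absConvex_pairing_polar p B).1
  refine (absorbs_iff_exists_real hbal).2 ⟨(max C 1)⁻¹, by positivity, fun v hv => ?_⟩
  have h1 : 0 < max C 1 := lt_max_of_lt_right one_pos
  rw [Set.mem_ofPred_eq]
  intro x hx
  rw [map_smul, LinearMap.smul_apply, norm_smul, RCLike.norm_ofReal, abs_of_pos (inv_pos.2 h1),
    ← div_eq_inv_mul, div_le_one h1]
  exact (hC v hv x hx).trans (le_max_left _ _)

theorem exists_smul_norm_le_of_isVonNBounded (hτ : IsLCHS 𝕜 τ)
    {S : Set (V)} (hS : IsVonNBounded 𝕜 S) {B : Set X}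
    (hB : IsBddIn 𝕜 τ B) :
    ∃ r : ℝ, 0 < r ∧ ∀ v ∈ S, ∀ x ∈ B, ‖p v ((r : 𝕜) • x)‖ ≤ 1 := by
  have hbal := (absConvex_pairing_polar p B).1
  obtain ⟨r, hr, h⟩ := exists_real_smul_mem_of_isVonNBounded hS
    ((hp.hasBasis hτ).mem_of_mem hB) hbal
  refine ⟨r, hr, fun v hv x hx => ?_⟩
  have h1 := h v hv
  rw [Set.mem_ofPred_eq, map_smul] at h1
  rw [map_smul]
  exact h1 x hx

theorem isLCHS (hτ : IsLCHS 𝕜 τ) (hle : τ ≤ τ') (h : BBCl 𝕜 τ τ') (hτ' : IsLCHS 𝕜 τ') :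
    IsLCHS 𝕜 tV := by
  let φ : V →ₗ[𝕜] X → 𝕜 :=
    { toFun := fun v => p v
      map_add' := fun v w => by rw [map_add]; rfl
      map_smul' := fun c v => by rw [map_smul]; rfl }
  refine ⟨hp.isTopologicalAddGroup, ?_, ?_, ?_⟩
  · refine UniformOnFun.continuousSMul_induced_of_image_bounded 𝕜 X 𝕜
      V (𝔖 := {B : Set X | IsBddIn 𝕜 τ B}) φ hp.isInducing fun v B hB => ?_
    obtain ⟨C, hC⟩ := hp.exists_norm_le hτ hle h hτ' v hB
    exact (NormedSpace.isVonNBounded_iff' 𝕜).2 ⟨C, Set.forall_mem_image.2 hC⟩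
  · have := hp.isTopologicalAddGroup
    exact LocallyConvexSpace.ofBasisZero 𝕜 _ _ _ (hp.hasBasis hτ) fun B _ =>
      (absConvex_pairing_polar p B).2
  · have : T2Space (UniformOnFun X 𝕜 {B : Set X | IsBddIn 𝕜 τ B}) :=
      UniformOnFun.t2Space_of_covering
        (Set.eq_univ_of_forall fun x => ⟨{x}, hτ.isBddIn_singleton x, rfl⟩)
    have hemb : IsEmbedding fun v => UniformOnFun.ofFun {B : Set X | IsBddIn 𝕜 τ B} (p v) :=
      ⟨hp.isInducing, fun v w hvw => hp.injective (LinearMap.ext fun x => congrFun hvw x)⟩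
    exact hemb.t2Space

/-- A countable cofinal family of bounded sets makes the uniformity countably generated.
Completeness is closedness of the range among all functions: a limit is linear by pointwise
convergence, and `τ'`-continuous on bounded sets by uniform convergence. -/
theorem isFrechet (hτ : IsLCHS 𝕜 τ) (hle : τ ≤ τ') (h : BBCl 𝕜 τ τ') (hτ' : IsLCHS 𝕜 τ')
    {B : ℕ → Set X} (hB : IsMixedBasis 𝕜 τ τ' B) : IsFrechet 𝕜 tV := by
  have hV := hp.isLCHS hτ hle h hτ'
  have := hV.topologicalAddGroup
  have := hV.t2
  let u : UniformSpace V := IsTopologicalAddGroup.rightUniformSpace V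
  have : IsUniformAddGroup V := isUniformAddGroup_of_addCommGroup
  let φ : V →+ UniformOnFun X 𝕜 {B : Set X | IsBddIn 𝕜 τ B} :=
    { toFun := fun v => UniformOnFun.ofFun _ (p v)
      map_zero' := by rw [map_zero]; rfl
      map_add' := fun v w => by rw [map_add]; rfl }
  have hφ : IsUniformInducing φ := AddMonoidHom.isUniformInducing_of_isInducing hp.isInducing
  refine ⟨hV, ?_, hV.topologicalAddGroup, ?_⟩
  · have h1 : Filter.IsCountablyGenerated
        (uniformity (UniformOnFun X 𝕜 {B : Set X | IsBddIn 𝕜 τ B})) :=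
      UniformOnFun.isCountablyGenerated_uniformity _ hB.bounded hB.monotone hB.basis
    have h2 : Filter.IsCountablyGenerated (uniformity V) := by
      rw [← hφ.comap_uniformity]
      infer_instance
    exact UniformSpace.metrizableSpace
  · rw [completeSpace_iff_isComplete_range hφ]
    refine IsClosed.isComplete (isClosed_of_closure_subset fun g hg => ?_)
    have hne : (Filter.comap φ (𝓝 g)).NeBot := Filter.comap_neBot_iff.2 fun t ht => by
      obtain ⟨_, hgt, v, rfl⟩ := mem_closure_iff_nhds.1 hg t ht
      exact ⟨v, hgt⟩
    have ht : Filter.Tendsto φ (Filter.comap φ (𝓝 g)) (𝓝 g) := Filter.tendsto_comap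
    rw [UniformOnFun.tendsto_iff_tendstoUniformlyOn] at ht
    have hpt : Filter.Tendsto (fun v x => p v x) (Filter.comap φ (𝓝 g))
        (𝓝 (UniformOnFun.toFun _ g)) :=
      tendsto_pi_nhds.2 fun x => (ht _ (hτ.isBddIn_singleton x)).tendsto_at rfl
    obtain ⟨v, hv⟩ := hp.exists_eq (linearMapOfTendsto _ _ hpt) fun B hB =>
      @TendstoUniformlyOn.continuousOn X 𝕜 V τ' _ _ _ _ _ (ht B hB)
        (Filter.Frequently.of_forall fun v => hp.continuousOn v B hB)
    exact ⟨v, congrArg (fun f : X →ₗ[𝕜] 𝕜 => UniformOnFun.ofFun _ f) hv⟩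

/-- The evaluation map from `X` into the strong dual of a candidate predual. -/
def eval (hτ : IsLCHS 𝕜 τ) : X →ₗ[𝕜] (V →L[𝕜] 𝕜) where
  toFun x := ⟨p.flip x,
    (UniformOnFun.uniformContinuous_eval (Set.eq_univ_of_forall fun x =>
      ⟨{x}, hτ.isBddIn_singleton x, rfl⟩) x).continuous.comp hp.isInducing.continuous⟩
  map_add' x y := ContinuousLinearMap.ext fun v => map_add (p v) x y
  map_smul' c x := ContinuousLinearMap.ext fun v => map_smul (p v) c x

theorem eval_apply (hτ : IsLCHS 𝕜 τ) (x : X) (v : V) : hp.eval hτ x v = p v x := rfl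

theorem exists_eq_of_continuous (f : X →ₗ[𝕜] 𝕜) (hf : @Continuous X 𝕜 τ' _ f) :
    ∃ v, p v = f :=
  hp.exists_eq f fun _ _ => @Continuous.continuousOn X 𝕜 τ' _ _ _ hf

theorem eval_injective (hτ : IsLCHS 𝕜 τ) (hτ' : IsLCHS 𝕜 τ') :
    Function.Injective (hp.eval hτ) := by
  rw [injective_iff_map_eq_zero]
  intro x hx
  by_contra hne
  have hcl : IsClosed[τ'] ({0} : Set X) :=
    @isClosed_singleton X τ' (@T2Space.t1Space X τ' hτ'.t2) 0
  obtain ⟨f, hf, -, hfx⟩ := hτ'.exists_dual_norm_le_one (absConvex_zero (𝕜 := 𝕜)) hcl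
    (Set.singleton_nonempty 0) (x := x) hne
  obtain ⟨v, rfl⟩ := hp.exists_eq_of_continuous f hf
  have := DFunLike.congr_fun hx v
  rw [eval_apply] at this
  simp [this] at hfx
  linarith

theorem eval_continuous (hτ : IsLCHS 𝕜 τ) (hborn : IsBornologicalTVS 𝕜 τ) (hV : IsLCHS 𝕜 tV) :
    Continuous (hp.eval hτ) := by
  have := hτ.topologicalAddGroup
  have := hV.continuousSMul
  refine continuous_of_continuousAt_zero (hp.eval hτ) ?_
  rw [ContinuousAt, map_zero, strongDual_hasBasis.tendsto_right_iff]
  intro S hS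
  refine hborn {x | ∀ v ∈ S, ‖p v x‖ ≤ 1} (absConvex_polar S p) fun B hB => ?_
  rw [absorbs_iff_exists_real (absConvex_polar S p).1]
  obtain ⟨r, hr, h⟩ := hp.exists_smul_norm_le_of_isVonNBounded hτ hS hB
  exact ⟨r, hr, fun x hx v hv => h v hv x hx⟩

/-- A continuous functional on V is dominated by the polar of a bounded set, which (BBC) enlarges to
a compact one; such a functional is evaluation at a point of that set. -/
theorem eval_surjective (hτ : IsLCHS 𝕜 τ) (h : BBC 𝕜 τ τ') : Function.Surjective (hp.eval hτ) := by
  intro φ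
  have h1 : {v | ‖φ v‖ ≤ 1} ∈ 𝓝 (0 : V) := by
    have := φ.continuous.tendsto 0 (Metric.closedBall_mem_nhds _ one_pos)
    filter_upwards [this] with v hv
    simpa using hv
  obtain ⟨B, hB, hBφ⟩ := (hp.hasBasis hτ).mem_iff.1 h1
  obtain ⟨C, hBC, hCa, hCb, hCc⟩ := h _ (hτ.isBddIn_insert 0 hB)
  obtain ⟨x, -, hx⟩ := @exists_mem_eval_eq_of_isCompact 𝕜 _ X _ _ τ' V _ _ p C hCa
    ⟨0, hBC (Set.mem_insert _ _)⟩ hCc (fun v => hp.continuousOn v C hCb) φ.toLinearMap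
    fun v hv => hBφ fun x hx => hv x (hBC (Set.mem_insert_of_mem _ hx))
  exact ⟨x, ContinuousLinearMap.ext fun v => (hx v).symm⟩

/-- The polar in V of a neighbourhood W is bounded, since W absorbs bounded sets. If W is
`τ'`-closed, points outside it are separated by `τ'`-continuous functionals, which lie in V, so W
contains its bipolar. -/
theorem exists_nhds_preimage_eval_subset (hτ : IsLCHS 𝕜 τ) (hτ' : IsLCHS 𝕜 τ') (h : CNC 𝕜 τ τ')
    (hV : IsLCHS 𝕜 tV) {U : Set X} (hU : U ∈ 𝓝 (0 : X)) :
    ∃ N ∈ 𝓝 (0 : V →L[𝕜] 𝕜), hp.eval hτ ⁻¹' N ⊆ U := by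
  have := hV.continuousSMul
  obtain ⟨W, hW, hWU, hWa, hWc⟩ := h U hU
  have hS : IsVonNBounded 𝕜 {v | ∀ x ∈ W, ‖p v x‖ ≤ 1} := by
    refine hp.isVonNBounded hτ fun B hB => ?_
    obtain ⟨r, hr, hrW⟩ := (absorbs_iff_exists_real hWa.1).1 (hB hW)
    exact ⟨r⁻¹, fun v hv => exists_norm_le_of_polar hr fun x hx => hv _ (hrW x hx)⟩
  refine ⟨_, strongDual_hasBasis.mem_of_mem hS, fun x hx => hWU ?_⟩
  by_contra hxW
  obtain ⟨f, hf, hfW, hfx⟩ := hτ'.exists_dual_norm_le_one hWa hWc ⟨0, mem_of_mem_nhds hW⟩ hxW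
  obtain ⟨v, rfl⟩ := hp.exists_eq_of_continuous f hf
  exact hfx.not_ge (hx v hfW)

theorem exists_continuousLinearEquiv (hτ : IsLCHS 𝕜 τ) (hborn : IsBornologicalTVS 𝕜 τ)
    (hτ' : IsLCHS 𝕜 τ') (hV : IsLCHS 𝕜 tV) (hs : Function.Surjective (hp.eval hτ))
    (ho : ∀ U ∈ 𝓝 (0 : X), ∃ N ∈ 𝓝 (0 : V →L[𝕜] 𝕜), hp.eval hτ ⁻¹' N ⊆ U) :
    ∃ e : X ≃L[𝕜] (V →L[𝕜] 𝕜), ∀ x v, e x v = p v x := by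
  have := hτ.topologicalAddGroup
  obtain ⟨e, he⟩ := exists_continuousLinearEquiv_of_bijective (hp.eval hτ)
    ⟨hp.eval_injective hτ hτ', hs⟩ (hp.eval_continuous hτ hborn hV) ho
  exact ⟨e, fun x v => by rw [he, eval_apply]⟩

end IsCandidatePairing

end CandidatePairing

/-! ### The concrete candidate predual. -/

section CandidatePredual

variable {𝕜 : Type} [RCLike 𝕜] {X : Type u} [AddCommGroup X] [Module 𝕜 X]

attribute [local instance] candidateTopology

/-- The pairing between the candidate predual and the space. -/
def candidatePairing (τ τ' : TopologicalSpace X) :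
    candidatePredual 𝕜 τ τ' →ₗ[𝕜] X →ₗ[𝕜] 𝕜 where
  toFun f := f.1
  map_add' _ _ := rfl
  map_smul' _ _ := rfl

theorem isCandidatePairing_candidatePairing (τ τ' : TopologicalSpace X) :
    IsCandidatePairing (V := candidatePredual 𝕜 τ τ') τ τ' (candidatePairing τ τ') where
  injective := Subtype.val_injective
  continuousOn v := v.2
  exists_eq f hf := ⟨⟨f, hf⟩, rfl⟩
  isInducing := ⟨rfl⟩

end CandidatePredual

/-! ### Barrelledness of the strong dual and openness of evaluation. -/

section Barrelled

variable {𝕜 : Type} [RCLike 𝕜] {E : Type*} [AddCommGroup E] [Module 𝕜 E]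

/-- By induction, the sum is the midpoint of the shifted sum and `w 0`. It keeps sums with
geometrically decaying weights inside U. -/
theorem AbsConvex.sum_two_inv_pow_smul_mem {U : Set E} (hU : AbsConvex 𝕜 U) (n : ℕ) :
    ∀ w : ℕ → E, (∀ k, w k ∈ U) → ∑ k ∈ Finset.range n, ((2 : 𝕜)⁻¹ ^ (k + 1)) • w k ∈ U := by
  induction n with
  | zero => exact fun w hw => by simpa using hU.zero_mem ⟨_, hw 0⟩
  | succ n ih =>
    intro w hw
    have h : (0 : 𝕜) ≤ 2⁻¹ := inv_nonneg.2 zero_le_two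
    have := hU.2 (ih (fun k => w (k + 1)) fun k => hw (k + 1)) (hw 0) h h (by norm_num)
    rw [Finset.smul_sum] at this
    rw [Finset.sum_range_succ']
    simpa [smul_smul, pow_succ' _ (_ + 1)] using this

theorem Seminorm.absConvex_setOf_le_one (q : Seminorm 𝕜 E) : AbsConvex 𝕜 {x | q x ≤ 1} := by
  constructor
  · rintro c hc _ ⟨x, hx, rfl⟩
    rw [Set.mem_ofPred_eq] at hx ⊢
    rw [map_smul_eq_mul]
    exact mul_le_one₀ hc (apply_nonneg q x) hx
  · intro x hx y hy a b ha hb hab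
    rw [Set.mem_ofPred_eq] at hx hy ⊢
    have h1 : ‖a‖ + ‖b‖ = 1 := by
      have : ((‖a‖ + ‖b‖ : ℝ) : 𝕜) = 1 := by
        rw [RCLike.ofReal_add, RCLike.norm_of_nonneg' ha, RCLike.norm_of_nonneg' hb, hab]
      exact_mod_cast this
    calc q (a • x + b • y) ≤ q (a • x) + q (b • y) := map_add_le_add _ _ _
      _ = ‖a‖ * q x + ‖b‖ * q y := by rw [map_smul_eq_mul, map_smul_eq_mul]
      _ ≤ ‖a‖ * 1 + ‖b‖ * 1 := by gcongr
      _ = 1 := by rw [mul_one, mul_one, h1]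

/-- On a barrelled space the polar of a pointwise bounded set of functionals is a neighbourhood of
zero. -/
theorem setOf_norm_le_one_mem_nhds_of_barrelled [TopologicalSpace E] [IsTopologicalAddGroup E]
    [ContinuousSMul 𝕜 E] [BarrelledSpace 𝕜 E] {S : Set (E →L[𝕜] 𝕜)}
    (h : ∀ x, ∃ C : ℝ, ∀ f ∈ S, ‖f x‖ ≤ C) : {x | ∀ f ∈ S, ‖f x‖ ≤ 1} ∈ 𝓝 (0 : E) := by
  let : UniformSpace E := IsTopologicalAddGroup.rightUniformSpace E
  have : IsUniformAddGroup E := isUniformAddGroup_of_addCommGroup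
  have hb := (norm_withSeminorms 𝕜 𝕜).banach_steinhaus (𝓕 := fun f : S => (f : E →L[𝕜] 𝕜))
    fun _ x => by
      obtain ⟨C, hC⟩ := h x
      exact ⟨C, by rintro _ ⟨f, rfl⟩; exact hC f f.2⟩
  have h0 := hb.equicontinuous 0 _ (Metric.dist_mem_uniformity one_pos)
  filter_upwards [h0] with x hx f hf
  have := hx ⟨f, hf⟩
  simp only [Function.comp_apply, map_zero, dist_zero_left] at this
  exact this.le

end Barrelled

namespace IsCandidatePairing

variable {𝕜 : Type} [RCLike 𝕜] {X : Type u} [AddCommGroup X] [Module 𝕜 X]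
  {V : Type u} [AddCommGroup V] [Module 𝕜 V] [tV : TopologicalSpace V]
  {τ' τ : TopologicalSpace X} {p : V →ₗ[𝕜] X →ₗ[𝕜] 𝕜} (hp : IsCandidatePairing τ τ' p)

include hp

/-- Otherwise evaluation at x is dominated by the polar of K, hence equals evaluation at a point of
K, and injectivity puts x in K. -/
theorem exists_norm_le_one_of_notMem (hτ : IsLCHS 𝕜 τ) (hτ' : IsLCHS 𝕜 τ') {K : Set X}
    (hK : AbsConvex 𝕜 K) (hne : K.Nonempty) (hKb : IsBddIn 𝕜 τ K) (hKc : @IsCompact X τ' K)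
    {x : X} (hx : x ∉ K) : ∃ v, (∀ y ∈ K, ‖p v y‖ ≤ 1) ∧ 1 < ‖p v x‖ := by
  by_contra! hcon
  obtain ⟨y, hy, hxy⟩ := @exists_mem_eval_eq_of_isCompact 𝕜 _ X _ _ τ' V _ _ p K hK hne hKc
    (fun v => hp.continuousOn v K hKb) (p.flip x) hcon
  exact hx (hp.eval_injective hτ hτ' (ContinuousLinearMap.ext hxy) ▸ hy)

/-- If the strong dual of the candidate predual is barrelled, then the evaluation map is open. -/
theorem exists_nhds_preimage_eval_subset_of_barrelled (hτ : IsLCHS 𝕜 τ) (hτ' : IsLCHS 𝕜 τ')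
    (hle : τ ≤ τ') (h : BBCl 𝕜 τ τ') (hs : Function.Surjective (hp.eval hτ))
    {B : ℕ → Set X} (hB : IsMixedBasis 𝕜 τ τ' B) (hBc : ∀ n, @IsCompact X τ' (B n))
    [BarrelledSpace 𝕜 (V →L[𝕜] 𝕜)] {U : Set X} (hU : U ∈ 𝓝 (0 : X)) :
    ∃ N ∈ 𝓝 (0 : V →L[𝕜] 𝕜), hp.eval hτ ⁻¹' N ⊆ U := by
  have hV := hp.isLCHS hτ hle h hτ'
  have := hV.continuousSMul
  have := hV.topologicalAddGroup
  have := hτ.topologicalAddGroup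
  have := hτ.continuousSMul
  obtain ⟨W, hW, hWa, hWU⟩ := hτ.exists_absConvex_nhds_subset hU
  choose r hr hrW using fun k => (absorbs_iff_exists_real hWa.1).1 (hB.bounded k hW)
  -- The exponent k + 2, rather than k + 1, leaves room for doubling: `K n` lies in half of W. The
  -- partial sums K n are `τ'`-compact, so points can be separated from each of them by elements of
  -- V.
  let c : ℕ → 𝕜 := fun k => (2 : 𝕜)⁻¹ ^ (k + 2) * (r k : 𝕜)
  have hc0 : ∀ k, c k ≠ 0 := fun k => mul_ne_zero (by simp) (by exact_mod_cast (hr k).ne')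
  let K : ℕ → Set X := fun n => ∑ k ∈ Finset.range n, c k • B k
  have hKa : ∀ n, AbsConvex 𝕜 (K n) := fun n =>
    absConvex_finsetSum _ fun k _ => (hB.absConvex k).smul_set _
  have hKsucc : ∀ n, K (n + 1) = K n + c n • B n := fun n => Finset.sum_range_succ _ _
  have hz : ∀ n, (0 : X) ∈ c n • B n := fun n => ⟨0, hB.zero_mem n, by simp⟩
  have hK0 : ∀ n, (0 : X) ∈ K n := fun n => by
    induction n with
    | zero => simp [K]
    | succ n ih => rw [hKsucc]; exact ⟨0, ih, 0, hz n, by simp⟩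
  have hKmono : Monotone K := monotone_nat_of_le_succ fun n x hx => by
    rw [hKsucc]; exact ⟨x, hx, 0, hz n, by simp⟩
  have hKb : ∀ n, IsBddIn 𝕜 τ (K n) := fun n => by
    induction n with
    | zero => exact hτ.isBddIn_singleton 0
    | succ n ih => rw [hKsucc]; exact IsVonNBounded.add ih (hτ.isBddIn_smul _ (hB.bounded n))
  have hKc : ∀ n, @IsCompact X τ' (K n) := fun n => by
    have h1 : @ContinuousAdd X τ' _ := hτ'.topologicalAddGroup.toContinuousAdd
    have h2 : @ContinuousConstSMul 𝕜 X τ' _ :=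
      @ContinuousSMul.continuousConstSMul 𝕜 X _ τ' _ hτ'.continuousSMul
    induction n with
    | zero => exact @isCompact_singleton X τ' 0
    | succ n ih =>
      rw [hKsucc]
      exact @IsCompact.add X τ' _ h1 _ _ ih (@IsCompact.smul 𝕜 X _ τ' h2 (c n) _ (hBc n))
  have hBK : ∀ k x, x ∈ B k → ∀ n, k < n → c k • x ∈ K n := fun k x hx n hn =>
    hKmono hn (by rw [hKsucc]; exact ⟨0, hK0 k, _, Set.smul_mem_smul_set hx, by simp⟩)
  have hKW : ∀ n x, x ∈ K n → (2 : 𝕜) • x ∈ W := by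
    intro n x hx
    obtain ⟨g, hg, rfl⟩ := (Set.mem_finsetSum _ _ _).1 hx
    choose! b hb hbg using fun k (hk : k ∈ Finset.range n) => hg hk
    have := hWa.sum_two_inv_pow_smul_mem n
      (fun k => if k ∈ Finset.range n then (r k : 𝕜) • b k else 0) fun k => by
        split_ifs with hk
        · exact hrW k _ (hb k hk)
        · exact hWa.zero_mem ⟨_, mem_of_mem_nhds hW⟩
    convert this using 1
    rw [Finset.smul_sum]
    refine Finset.sum_congr rfl fun k hk => ?_
    rw [if_pos hk, ← hbg k hk]
    simp only [c, smul_smul]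
    congr 1
    rw [pow_succ' _ (k + 1)]
    ring_nf
  let A : Set X := ⋃ n, K n
  have hAa : AbsConvex 𝕜 A :=
    ⟨balanced_iUnion fun n => (hKa n).1, hKmono.directed_le.convex_iUnion fun n => (hKa n).2⟩
  let I := hp.eval hτ
  -- A absorbs every point, so its polar is pointwise bounded; barrelledness makes the bipolar, that
  -- is the closure of the image of A, a neighbourhood of zero.
  have hpt : ∀ y : V →L[𝕜] 𝕜, ∃ C : ℝ, ∀ ψ ∈ {ψ : (V →L[𝕜] 𝕜) →L[𝕜] 𝕜 | ∀ a ∈ A, ‖ψ (I a)‖ ≤ 1},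
      ‖ψ y‖ ≤ C := by
    intro y
    obtain ⟨x, rfl⟩ := hs y
    obtain ⟨k, hk⟩ := hB.basis _ (hτ.isBddIn_singleton x)
    refine ⟨‖c k‖⁻¹, fun ψ hψ => ?_⟩
    have h1 := hψ (c k • x) (Set.mem_iUnion.2 ⟨k + 1, hBK k x (hk rfl) _ k.lt_succ_self⟩)
    rw [map_smul, map_smul, norm_smul] at h1
    rw [← one_div, le_div_iff₀ (norm_pos_iff.2 (hc0 k)), mul_comm]
    exact h1
  refine ⟨_, setOf_norm_le_one_mem_nhds_of_barrelled hpt, fun x hx => hWU ?_⟩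
  have hcl : I x ∈ closure (I '' A) := by
    by_contra hcon
    obtain ⟨ψ, hψ, hψx⟩ := exists_dual_norm_le_one_of_notMem (hAa.image_linearMap I).closure
      isClosed_closure ⟨I 0, subset_closure ⟨0, Set.mem_iUnion.2 ⟨0, hK0 0⟩, rfl⟩⟩ hcon
    exact hψx.not_ge (hx ψ fun a ha => hψ _ (subset_closure ⟨a, ha, rfl⟩))
  by_contra hxW
  have hxK : ∀ n, (2 : 𝕜)⁻¹ • x ∉ K n := fun n hn => hxW (by simpa using hKW n _ hn)
  -- If x is outside W, then x/2 avoids every K n. The separating functionals form a bounded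
  -- sequence in V, so its polar is a neighbourhood of zero in the strong dual and x can be
  -- approximated by some a in A uniformly on the sequence.
  choose v hv hvx using fun n =>
    hp.exists_norm_le_one_of_notMem hτ hτ' (hKa n) ⟨0, hK0 n⟩ (hKb n) (hKc n) (hxK n)
  have hvb : IsVonNBounded 𝕜 (Set.range v) := by
    refine hp.isVonNBounded hτ fun D hD => ?_
    obtain ⟨k, hk⟩ := hB.basis D hD
    choose M hM using fun n => hp.exists_norm_le hτ hle h hτ' (v n) (hB.bounded k)
    -- For n > k the set K n contains `c k • B k`, which gives a bound independent of n; the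
    -- finitely many n ≤ k are bounded one at a time.
    refine ⟨‖c k‖⁻¹ + ∑ n ∈ Finset.range (k + 1), |M n|, ?_⟩
    rintro _ ⟨n, rfl⟩ x hx
    by_cases hn : k < n
    · have h1 := hv n _ (hBK k x (hk hx) n hn)
      rw [map_smul, norm_smul, mul_comm, ← le_div_iff₀ (norm_pos_iff.2 (hc0 k)), one_div] at h1
      exact h1.trans (le_add_of_nonneg_right (Finset.sum_nonneg fun _ _ => abs_nonneg _))
    · refine (hM n x (hk hx)).trans ((le_abs_self _).trans ?_)
      refine (Finset.single_le_sum (f := fun n => |M n|) (fun _ _ => abs_nonneg _)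
        (Finset.mem_range.2 (by omega : n < k + 1))).trans (le_add_of_nonneg_left ?_)
      positivity
  have hN := strongDual_hasBasis.mem_of_mem hvb
  have hN' : (fun y => y - I x) ⁻¹' {f : V →L[𝕜] 𝕜 | ∀ w ∈ Set.range v, ‖f w‖ ≤ 1} ∈ 𝓝 (I x) :=
    (continuous_id.sub continuous_const).continuousAt.preimage_mem_nhds (by simpa using hN)
  obtain ⟨_, ha, a, haA, rfl⟩ := mem_closure_iff_nhds.1 hcl _ hN'
  -- For this n, `v n` is at most 1 in norm at a and on a - x, but exceeds 2 at x.
  obtain ⟨n, hn⟩ := Set.mem_iUnion.1 haA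
  have h1 : ‖p (v n) a - p (v n) x‖ ≤ 1 := ha (v n) ⟨n, rfl⟩
  have h2 := hv n a hn
  have h3 := hvx n
  rw [map_smul, norm_smul, norm_inv, RCLike.norm_ofNat] at h3
  have h4 := norm_sub_norm_le (p (v n) x) (p (v n) a)
  rw [norm_sub_rev] at h4
  linarith

/-- If the evaluation map is a topological isomorphism from a bornological space, then the strong
dual of the candidate predual is barrelled. -/
theorem barrelledSpace_strongDual (hτ : IsLCHS 𝕜 τ) (hborn : IsBornologicalTVS 𝕜 τ)
    (hV : IsLCHS 𝕜 tV) (e : X ≃L[𝕜] (V →L[𝕜] 𝕜)) (he : ∀ x v, e x v = p v x) :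
    BarrelledSpace 𝕜 (V →L[𝕜] 𝕜) := by
  have := hV.continuousSMul
  have := hV.topologicalAddGroup
  refine ⟨fun q hq => ?_⟩
  have hbdd : ∀ B : Set X, IsBddIn 𝕜 τ B → ∃ C : ℝ, ∀ x ∈ B, q (e x) ≤ C := by
    intro B hB
    by_contra! hcon
    choose x hxB hx using fun n : ℕ => hcon n
    have hbd : ∀ v, ∃ C : ℝ, ∀ n, ‖p v (x n)‖ ≤ C := by
      intro v
      obtain ⟨r, hr, h⟩ := hp.exists_smul_norm_le_of_isVonNBounded hτ
        (isVonNBounded_singleton v) hB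
      exact ⟨r⁻¹, fun n => exists_norm_le_of_polar hr (h v rfl) _ (hxB n)⟩
    -- If q were unbounded on B, take a sequence in B along which it grows. Summing its evaluations
    -- against ℓ¹ coefficients gives a continuous map T from a Banach space, where the lower
    -- semicontinuous seminorm `q.comp T` is continuous; this bounds q along the sequence, the
    -- images of the unit vectors.
    have hasum : ∀ a : lp (fun _ : ℕ => 𝕜) 1, HasSum (fun n => ‖a n‖) ‖a‖ := fun a => by
      simpa using lp.hasSum_norm (p := 1) (by simp) a
    have hle : ∀ (a : lp (fun _ : ℕ => 𝕜) 1) v C, (∀ n, ‖p v (x n)‖ ≤ C) →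
        Summable (fun n => a n * p v (x n)) ∧ ‖∑' n, a n * p v (x n)‖ ≤ ‖a‖ * C := by
      intro a v C hC
      have h1 : ∀ n, ‖a n * p v (x n)‖ ≤ ‖a n‖ * C := fun n => by
        rw [norm_mul]
        exact mul_le_mul_of_nonneg_left (hC n) (norm_nonneg _)
      have h2 := (hasum a).mul_right C
      exact ⟨Summable.of_norm_bounded h2.summable h1, tsum_of_norm_bounded h2 h1⟩
    have hsum : ∀ (a : lp (fun _ : ℕ => 𝕜) 1) v, Summable (fun n => a n * p v (x n)) :=
      fun a v => (hle a v _ (hbd v).choose_spec).1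
    let T₀ : lp (fun _ : ℕ => 𝕜) 1 → V →ₗ[𝕜] 𝕜 := fun a =>
      { toFun := fun v => ∑' n, a n * p v (x n)
        map_add' := fun v w => by
          simp only [map_add, LinearMap.add_apply, mul_add]
          exact (hsum a v).tsum_add (hsum a w)
        map_smul' := fun c v => by
          simp only [map_smul, LinearMap.smul_apply, smul_eq_mul, RingHom.id_apply]
          rw [← tsum_mul_left]
          exact tsum_congr fun n => by ring }
    have hT₀ : ∀ a, Continuous (T₀ a) := fun a => by
      refine continuous_of_continuousAt_zero (T₀ a) ?_
      rw [ContinuousAt, map_zero, Metric.nhds_basis_closedBall.tendsto_right_iff]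
      intro ε hε
      have hδ : 0 < ε / (‖a‖ + 1) := by positivity
      have hδ0 : ((ε / (‖a‖ + 1) : ℝ) : 𝕜) ≠ 0 := by exact_mod_cast hδ.ne'
      have hmem := (set_smul_mem_nhds_zero_iff hδ0).2 ((hp.hasBasis hτ).mem_of_mem hB)
      filter_upwards [hmem] with v hv
      obtain ⟨w, hw, rfl⟩ := hv
      rw [mem_closedBall_zero_iff, map_smul, norm_smul, RCLike.norm_ofReal, abs_of_pos hδ]
      have := (hle a w 1 fun n => hw _ (hxB n)).2
      rw [mul_one] at this
      calc ε / (‖a‖ + 1) * ‖T₀ a w‖ ≤ ε / (‖a‖ + 1) * (‖a‖ + 1) :=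
            mul_le_mul_of_nonneg_left (this.trans (by linarith)) hδ.le
        _ = ε := div_mul_cancel₀ _ (by positivity)
    let T : lp (fun _ : ℕ => 𝕜) 1 →ₗ[𝕜] (V →L[𝕜] 𝕜) :=
      { toFun := fun a => ⟨T₀ a, hT₀ a⟩
        map_add' := fun a b => ContinuousLinearMap.ext fun v => by
          change ∑' n, (a n + b n) * p v (x n) = ∑' n, a n * p v (x n) + ∑' n, b n * p v (x n)
          rw [← (hsum a v).tsum_add (hsum b v)]
          exact tsum_congr fun n => by ring
        map_smul' := fun c a => ContinuousLinearMap.ext fun v => by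
          change ∑' n, (c * a n) * p v (x n) = c * ∑' n, a n * p v (x n)
          rw [← tsum_mul_left]
          exact tsum_congr fun n => by ring }
    have hT : Continuous T := by
      refine continuous_of_continuousAt_zero T ?_
      rw [ContinuousAt, map_zero, strongDual_hasBasis.tendsto_right_iff]
      intro S hS
      obtain ⟨r, hr, h⟩ := hp.exists_smul_norm_le_of_isVonNBounded hτ hS hB
      filter_upwards [Metric.closedBall_mem_nhds (0 : lp (fun _ : ℕ => 𝕜) 1) hr] with a ha
      intro v hv
      have h1 := (hle a v r⁻¹ fun n => exists_norm_le_of_polar hr (h v hv) _ (hxB n)).2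
      refine h1.trans ?_
      rw [← div_eq_mul_inv, div_le_one hr]
      simpa using ha
    have hqT : Continuous (q.comp T) :=
      Seminorm.continuous_of_lowerSemicontinuous _ (hq.comp hT)
    obtain ⟨C, hC, hqC⟩ := Seminorm.bound_of_continuous_normedSpace _ hqT
    obtain ⟨n, hn⟩ := exists_nat_gt C
    have h1 := hqC (lp.single 1 n (1 : 𝕜))
    have h2 : T (lp.single 1 n (1 : 𝕜)) = e (x n) := ContinuousLinearMap.ext fun v => by
      change ∑' m, (lp.single 1 n (1 : 𝕜) : lp (fun _ : ℕ => 𝕜) 1) m * p v (x m) = e (x n) v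
      rw [tsum_eq_single n, he]
      · simp
      · intro m hm
        simp [hm]
    rw [Seminorm.comp_apply, h2, lp.norm_single (by simp), norm_one, mul_one] at h1
    exact (hx n).not_ge (h1.trans hn.le)
  -- A seminorm bounded on bounded sets is continuous because X is bornological.
  have hU : {x | q (e x) ≤ 1} ∈ 𝓝 (0 : X) := by
    have h0 : AbsConvex 𝕜 {x | q (e x) ≤ 1} :=
      (q.comp (e : X →ₗ[𝕜] (V →L[𝕜] 𝕜))).absConvex_setOf_le_one
    refine hborn _ h0 fun B hB => ?_
    rw [absorbs_iff_exists_real h0.1]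
    obtain ⟨C, hC⟩ := hbdd B hB
    have h1 : 0 < max C 1 := lt_max_of_lt_right one_pos
    refine ⟨(max C 1)⁻¹, inv_pos.2 h1, fun x hx => ?_⟩
    rw [Set.mem_ofPred_eq, map_smul, map_smul_eq_mul, RCLike.norm_ofReal,
      abs_of_pos (inv_pos.2 h1), ← div_eq_inv_mul, div_le_one h1]
    exact (hC x hx).trans (le_max_left _ _)
  refine Seminorm.continuous' (r := 1) ?_
  have h2 := e.symm.continuous.tendsto 0
  rw [map_zero] at h2
  filter_upwards [h2 hU] with y hy
  simpa [Seminorm.mem_closedBall] using hy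

end IsCandidatePairing

/-! ### The mixed topology: neighbourhoods, dual and bounded sets. -/

section OneTopology

variable {𝕜 : Type} [RCLike 𝕜] {X : Type u} [AddCommGroup X] [Module 𝕜 X]
  {τ : TopologicalSpace X}

theorem IsLCHS.setOf_sub_mem_mem_nhds (hτ : IsLCHS 𝕜 τ) (x : X) {U : Set X} (hU : U ∈ 𝓝 (0 : X)) :
    {y | y - x ∈ U} ∈ 𝓝 x := by
  have := hτ.topologicalAddGroup
  have hcont : Continuous fun y => y - x := continuous_id.sub continuous_const
  refine hcont.continuousAt.preimage_mem_nhds ?_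
  rwa [sub_self]

theorem continuous_of_preimage_closedBall_mem_nhds (hτ : IsTopologicalAddGroup X)
    (f : X →ₗ[𝕜] 𝕜) (h : ∀ ε > 0, f ⁻¹' Metric.closedBall 0 ε ∈ 𝓝 (0 : X)) : Continuous f := by
  refine continuous_of_continuousAt_zero f ?_
  rw [ContinuousAt, map_zero, Metric.nhds_basis_closedBall.tendsto_right_iff]
  exact h

theorem isBddIn_of_hasBasis {ι : Type*} {q : ι → Prop} {s : ι → Set X}
    (hb : (𝓝 (0 : X)).HasBasis q s) {C : Set X} (h : ∀ i, q i → Absorbs 𝕜 (s i) C) :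
    IsBddIn 𝕜 τ C :=
  hb.isVonNBounded_iff.2 h

theorem setOf_norm_smul_apply_smul_le_one_mem_nhds {f : X →ₗ[𝕜] 𝕜} (hf : Continuous f)
    (d c : 𝕜) : {x | ‖(d • f) (c • x)‖ ≤ 1} ∈ 𝓝 (0 : X) := by
  have hc : Continuous fun x => ‖c * (d * f x)‖ := by fun_prop
  have := hc.continuousAt.preimage_mem_nhds (x := 0) (t := Set.Iic 1)
    (by simpa using Iic_mem_nhds one_pos)
  exact Filter.mem_of_superset this fun x hx => by simpa using hx

end OneTopology

section MixedTopology

variable {𝕜 : Type} [RCLike 𝕜] {X : Type u} [AddCommGroup X] [Module 𝕜 X]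
  {τ' τ : TopologicalSpace X} {B : ℕ → Set X} (hB : IsMixedBasis 𝕜 τ τ' B)

theorem IsNhdSeq.zero_mem {U : ℕ → Set X} (hU : IsNhdSeq 𝕜 τ' U) (n : ℕ) : (0 : X) ∈ U n :=
  @mem_of_mem_nhds X τ' 0 _ (hU n).1

theorem mem_mixedNhd_iff {U : ℕ → Set X} {x : X} :
    x ∈ mixedNhd B U ↔
      ∃ n, ∃ a : ℕ → X, (∀ k < n, a k ∈ U k ∩ B k) ∧ ∑ k ∈ Finset.range n, a k = x ∧ 0 < n := by
  simp only [mixedNhd, Set.mem_iUnion, Set.mem_finsetSum]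
  constructor
  · rintro ⟨n, a, ha, rfl⟩
    exact ⟨n + 1, a, fun k hk => ha (Finset.mem_range.2 hk), rfl, n.succ_pos⟩
  · rintro ⟨n, a, ha, rfl, hn⟩
    obtain ⟨n, rfl⟩ := Nat.exists_eq_succ_of_ne_zero hn.ne'
    exact ⟨n, a, fun {k} hk => ha k (Finset.mem_range.1 hk), rfl⟩

namespace IsMixedBasis

include hB

/-- The elements of `mixedNhd B U` are the sums of finitely many elements of the sets `U k ∩ B k`,
where the number of summands may be enlarged. -/
theorem exists_sum_of_mem_mixedNhd {U : ℕ → Set X} (hU : IsNhdSeq 𝕜 τ' U) {x : X}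
    (hx : x ∈ mixedNhd B U) :
    ∃ N, ∀ n ≥ N, ∃ a : ℕ → X, (∀ k, a k ∈ U k ∩ B k) ∧ ∑ k ∈ Finset.range n, a k = x := by
  obtain ⟨N, a, ha, rfl, -⟩ := mem_mixedNhd_iff.1 hx
  refine ⟨N, fun n hn => ⟨fun k => if k < N then a k else 0, fun k => ?_, ?_⟩⟩
  · dsimp only
    split_ifs with hk
    · exact ha k hk
    · exact ⟨hU.zero_mem k, hB.zero_mem k⟩
  · rw [← Finset.sum_subset (Finset.range_mono hn)]
    · exact Finset.sum_congr rfl fun k hk => if_pos (Finset.mem_range.1 hk)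
    · exact fun k _ hk => if_neg fun h => hk (Finset.mem_range.2 h)

theorem sum_mem_mixedNhd {U : ℕ → Set X} (hU : IsNhdSeq 𝕜 τ' U) {a : ℕ → X} (n : ℕ)
    (ha : ∀ k < n, a k ∈ U k ∩ B k) : ∑ k ∈ Finset.range n, a k ∈ mixedNhd B U := by
  rcases n.eq_zero_or_pos with rfl | hn
  · refine mem_mixedNhd_iff.2 ⟨1, fun _ => 0, fun k _ => ⟨hU.zero_mem k, hB.zero_mem k⟩, ?_, ?_⟩ <;>
      simp
  · exact mem_mixedNhd_iff.2 ⟨n, a, ha, rfl, hn⟩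

theorem inter_subset_mixedNhd {U : ℕ → Set X} (hU : IsNhdSeq 𝕜 τ' U) (k : ℕ) :
    U k ∩ B k ⊆ mixedNhd B U := by
  intro x hx
  have := hB.sum_mem_mixedNhd hU (a := fun j => if j = k then x else 0) (k + 1) fun j _ => by
    split_ifs with hj
    · exact hj ▸ hx
    · exact ⟨hU.zero_mem j, hB.zero_mem j⟩
  simpa using this

theorem zero_mem_mixedNhd {U : ℕ → Set X} (hU : IsNhdSeq 𝕜 τ' U) : (0 : X) ∈ mixedNhd B U :=
  hB.inter_subset_mixedNhd hU 0 ⟨hU.zero_mem 0, hB.zero_mem 0⟩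

theorem absConvex_mixedNhd {U : ℕ → Set X} (hU : IsNhdSeq 𝕜 τ' U) :
    AbsConvex 𝕜 (mixedNhd B U) := by
  have hUB : ∀ k, AbsConvex 𝕜 (U k ∩ B k) := fun k => (hU k).2.inter (hB.absConvex k)
  constructor
  · rintro c hc _ ⟨x, hx, rfl⟩
    obtain ⟨n, a, ha, rfl, -⟩ := mem_mixedNhd_iff.1 hx
    simp only [Finset.smul_sum]
    exact hB.sum_mem_mixedNhd hU n fun k hk => (hUB k).smul_mem_of_norm_le hc (ha k hk)
  · intro x hx y hy c d hc hd hcd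
    obtain ⟨N, hN⟩ := hB.exists_sum_of_mem_mixedNhd hU hx
    obtain ⟨M, hM⟩ := hB.exists_sum_of_mem_mixedNhd hU hy
    obtain ⟨a, ha, rfl⟩ := hN _ (le_max_left N M)
    obtain ⟨b, hb, rfl⟩ := hM _ (le_max_right N M)
    rw [Finset.smul_sum, Finset.smul_sum, ← Finset.sum_add_distrib]
    exact hB.sum_mem_mixedNhd hU _ fun k _ => (hUB k).2 (ha k) (hb k) hc hd hcd

/-- The sum of two elements of `B k` lies in `B (k + 1)`, so adding two sums shifts every index by
one; W is therefore built from the halves of `U (k + 1)`, and slot 0 is filled by 0. -/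
theorem exists_add_mem_mixedNhd (hτ' : IsLCHS 𝕜 τ') {U : ℕ → Set X} (hU : IsNhdSeq 𝕜 τ' U) :
    ∃ W, IsNhdSeq 𝕜 τ' W ∧ ∀ x ∈ mixedNhd B W, ∀ y ∈ mixedNhd B W, x + y ∈ mixedNhd B U := by
  have h2 : (2 : 𝕜)⁻¹ ≠ 0 := by simp
  have hW : IsNhdSeq 𝕜 τ' fun k => (2 : 𝕜)⁻¹ • U (k + 1) :=
    fun k => ⟨hτ'.smul_mem_nhds (hU (k + 1)).1 h2, (hU (k + 1)).2.smul_set _⟩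
  refine ⟨_, hW, fun x hx y hy => ?_⟩
  obtain ⟨N, hN⟩ := hB.exists_sum_of_mem_mixedNhd hW hx
  obtain ⟨M, hM⟩ := hB.exists_sum_of_mem_mixedNhd hW hy
  obtain ⟨a, ha, rfl⟩ := hN _ (le_max_left N M)
  obtain ⟨b, hb, rfl⟩ := hM _ (le_max_right N M)
  have hhalf : (0 : 𝕜) ≤ 2⁻¹ := inv_nonneg.2 zero_le_two
  have hmem : ∀ k, a k + b k ∈ U (k + 1) ∩ B (k + 1) := by
    intro k
    constructor
    · obtain ⟨u, hu, hua⟩ := (ha k).1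
      obtain ⟨w, hw, hwb⟩ := (hb k).1
      rw [← hua, ← hwb]
      exact (hU (k + 1)).2.2 hu hw hhalf hhalf (by norm_num)
    · refine hB.two_smul_subset k ⟨_, (hB.absConvex k).2 (ha k).2 (hb k).2 hhalf hhalf
        (by norm_num), ?_⟩
      simp [smul_smul]
  have := hB.sum_mem_mixedNhd hU (a := fun k => Nat.casesOn k 0 fun j => a j + b j)
    (max N M + 1) fun k _ => by
      cases k with
      | zero => exact ⟨hU.zero_mem 0, hB.zero_mem 0⟩
      | succ k => exact hmem k
  rw [Finset.sum_range_succ'] at this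
  simpa [Finset.sum_add_distrib] using this

theorem mem_nhds_mixedTopology_iff (hτ' : IsLCHS 𝕜 τ') {s : Set X} {x : X} :
    s ∈ @nhds X (mixedTopology 𝕜 τ τ') x ↔
      ∃ U, IsNhdSeq 𝕜 τ' U ∧ ∀ y ∈ mixedNhd B U, x + y ∈ s := by
  rw [@mem_nhds_iff X (mixedTopology 𝕜 τ τ')]
  constructor
  · rintro ⟨t, hts, ht, hx⟩
    obtain ⟨U, hU, h⟩ := (isOpen_mixedTopology_iff hB t).1 ht x hx
    exact ⟨U, hU, fun y hy => hts (h y hy)⟩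
  · intro h
    refine ⟨{z | ∃ U, IsNhdSeq 𝕜 τ' U ∧ ∀ y ∈ mixedNhd B U, z + y ∈ s}, ?_, ?_, h⟩
    · rintro z ⟨U, hU, hz⟩
      simpa using hz 0 (hB.zero_mem_mixedNhd hU)
    · rw [isOpen_mixedTopology_iff hB]
      rintro z ⟨U, hU, hz⟩
      obtain ⟨W, hW, hWU⟩ := hB.exists_add_mem_mixedNhd hτ' hU
      exact ⟨W, hW, fun y hy => ⟨W, hW, fun w hw => by
        rw [add_assoc]
        exact hz _ (hWU y hy w hw)⟩⟩

theorem hasBasis_nhds_zero_mixedTopology (hτ' : IsLCHS 𝕜 τ') :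
    (@nhds X (mixedTopology 𝕜 τ τ') 0).HasBasis (IsNhdSeq 𝕜 τ') (mixedNhd B) :=
  ⟨fun s => by
    rw [hB.mem_nhds_mixedTopology_iff hτ']
    simp [Set.subset_def]⟩

theorem exists_two_pow_smul_mem_mixedNhd (hτ' : IsLCHS 𝕜 τ') (n : ℕ) :
    ∀ {U : ℕ → Set X}, IsNhdSeq 𝕜 τ' U →
      ∃ W, IsNhdSeq 𝕜 τ' W ∧ ∀ x ∈ mixedNhd B W, (2 : 𝕜) ^ n • x ∈ mixedNhd B U := by
  induction n with
  | zero => exact fun hU => ⟨_, hU, fun x hx => by simpa using hx⟩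
  | succ n ih =>
    intro U hU
    obtain ⟨W, hW, hWU⟩ := hB.exists_add_mem_mixedNhd hτ' hU
    obtain ⟨W', hW', h⟩ := ih hW
    refine ⟨W', hW', fun x hx => ?_⟩
    rw [pow_succ', mul_smul, two_smul]
    exact hWU _ (h x hx) _ (h x hx)

/-- An absolutely convex set is a neighbourhood of zero for the mixed topology if suitable multiples
of its traces on the sets `B k` are relative neighbourhoods of zero. -/
theorem mem_nhds_zero_mixedTopology (hτ' : IsLCHS 𝕜 τ') {P : Set X} (hP : AbsConvex 𝕜 P)
    (h : ∀ k, ∃ U ∈ @nhds X τ' 0, ∀ x ∈ U ∩ B k, (2 : 𝕜) ^ (k + 1) • x ∈ P) :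
    P ∈ @nhds X (mixedTopology 𝕜 τ τ') 0 := by
  choose U hU hUP using h
  choose W hW hWa hWU using fun k => hτ'.exists_absConvex_nhds_subset (hU k)
  have hWs : IsNhdSeq 𝕜 τ' W := fun k => ⟨hW k, hWa k⟩
  refine (hB.hasBasis_nhds_zero_mixedTopology hτ').mem_iff.2 ⟨W, hWs, fun x hx => ?_⟩
  obtain ⟨N, hN⟩ := hB.exists_sum_of_mem_mixedNhd hWs hx
  obtain ⟨a, ha, rfl⟩ := hN N le_rfl
  have := hP.sum_two_inv_pow_smul_mem N (fun k => (2 : 𝕜) ^ (k + 1) • a k)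
    fun k => hUP k _ ⟨hWU k (ha k).1, (ha k).2⟩
  simpa [smul_smul, ← mul_pow] using this

theorem isTopologicalAddGroup_mixedTopology (hτ' : IsLCHS 𝕜 τ') :
    @IsTopologicalAddGroup X (mixedTopology 𝕜 τ τ') _ := by
  let γ : TopologicalSpace X := mixedTopology 𝕜 τ τ'
  have hb : (𝓝 (0 : X)).HasBasis (IsNhdSeq 𝕜 τ') (mixedNhd B) :=
    hB.hasBasis_nhds_zero_mixedTopology hτ'
  refine IsTopologicalAddGroup.of_comm_of_nhds_zero ?_ ?_ fun x => ?_
  · rw [(hb.prod_self).tendsto_iff hb]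
    intro U hU
    obtain ⟨W, hW, h⟩ := hB.exists_add_mem_mixedNhd hτ' hU
    exact ⟨W, hW, fun z hz => h _ hz.1 _ hz.2⟩
  · rw [hb.tendsto_iff hb]
    refine fun U hU => ⟨U, hU, fun x hx => ?_⟩
    simpa using (hB.absConvex_mixedNhd hU).smul_mem_of_norm_le (c := -1) (by simp) hx
  · ext s
    rw [Filter.mem_map, hb.mem_iff]
    exact hB.mem_nhds_mixedTopology_iff hτ'

theorem mixedTopology_le (hτ' : IsLCHS 𝕜 τ') : mixedTopology 𝕜 τ τ' ≤ τ' := by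
  refine le_of_nhds_zero_le (hB.isTopologicalAddGroup_mixedTopology hτ') hτ' fun U hU hUa => ?_
  refine hB.mem_nhds_zero_mixedTopology hτ' hUa fun k => ?_
  have h2 : ((2 : 𝕜) ^ (k + 1)) ≠ 0 := by simp
  refine ⟨((2 : 𝕜) ^ (k + 1))⁻¹ • U, hτ'.smul_mem_nhds hU (inv_ne_zero h2), ?_⟩
  rintro _ ⟨⟨x, hx, rfl⟩, -⟩
  simpa [smul_smul, h2] using hx

theorem isLCHS_mixedTopology (hτ : IsLCHS 𝕜 τ) (hτ' : IsLCHS 𝕜 τ') :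
    IsLCHS 𝕜 (mixedTopology 𝕜 τ τ') := by
  have hgrp := hB.isTopologicalAddGroup_mixedTopology hτ'
  have hb := hB.hasBasis_nhds_zero_mixedTopology hτ'
  refine ⟨hgrp, ?_, ?_, ?_⟩
  · let γ : TopologicalSpace X := mixedTopology 𝕜 τ τ'
    refine ContinuousSMul.of_basis_zero hb ?_ ?_ ?_
    · intro U hU
      refine ⟨Metric.closedBall 0 1, Metric.closedBall_mem_nhds _ one_pos, U, hU, ?_⟩
      rintro _ ⟨c, hc, x, hx, rfl⟩
      exact (hB.absConvex_mixedNhd hU).smul_mem_of_norm_le (by simpa using hc) hx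
    · intro c U hU
      obtain ⟨n, hn⟩ := pow_unbounded_of_one_lt ‖c‖ (one_lt_two)
      obtain ⟨W, hW, h⟩ := hB.exists_two_pow_smul_mem_mixedNhd hτ' n hU
      refine ⟨W, hW, fun x hx => ?_⟩
      have h2 : (2 : 𝕜) ^ n ≠ 0 := by simp
      have := (hB.absConvex_mixedNhd hU).smul_mem_of_norm_le (c := c * ((2 : 𝕜) ^ n)⁻¹) (by
        rw [norm_mul, norm_inv, norm_pow, RCLike.norm_ofNat, ← div_eq_mul_inv]
        exact (div_le_one (by positivity)).2 hn.le) (h x hx)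
      simpa [smul_smul, mul_assoc, h2] using this
    · intro x U hU
      obtain ⟨k, hk⟩ := hB.basis _ (hτ.isBddIn_singleton x)
      obtain ⟨r, hr, hrU⟩ := (absorbs_iff_exists_real (hU k).2.1).1
        ((hτ'.isBddIn_singleton x) (hU k).1)
      filter_upwards [Metric.closedBall_mem_nhds (0 : 𝕜) (lt_min hr one_pos)] with c hc
      rw [mem_closedBall_zero_iff, le_min_iff] at hc
      refine hB.inter_subset_mixedNhd hU k
        ⟨?_, (hB.absConvex k).smul_mem_of_norm_le hc.2 (hk rfl)⟩
      have hr0 : (r : 𝕜) ≠ 0 := by exact_mod_cast hr.ne'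
      have := (hU k).2.smul_mem_of_norm_le (c := c * (r : 𝕜)⁻¹) (by
        rw [norm_mul, norm_inv, RCLike.norm_ofReal, abs_of_pos hr, ← div_eq_mul_inv]
        exact (div_le_one hr).2 hc.1) (hrU x rfl)
      simpa [smul_smul, mul_assoc, hr0] using this
  · exact @LocallyConvexSpace.ofBasisZero 𝕜 X _ _ _ _ (mixedTopology 𝕜 τ τ') hgrp _ _ _ hb
      fun U hU => (hB.absConvex_mixedNhd hU).2
  · exact t2Space_antitone (hB.mixedTopology_le hτ') hτ'.t2

/-- On the bounded sets the mixed topology is coarser than `τ'`. -/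
theorem continuousOn_id_mixedTopology (hτ' : IsLCHS 𝕜 τ') {C : Set X} (hC : IsBddIn 𝕜 τ C) :
    @ContinuousOn X X τ' (mixedTopology 𝕜 τ τ') id C := by
  intro x hx s hs
  obtain ⟨k, hk⟩ := hB.basis C hC
  obtain ⟨U, hU, hUs⟩ := (hB.mem_nhds_mixedTopology_iff hτ').1 hs
  refine Filter.mem_map.2 ((@mem_nhdsWithin_iff_exists_mem_nhds_inter X τ' _ _ _).2
    ⟨{y | y - x ∈ U (k + 1)}, ?_, ?_⟩)
  · exact hτ'.setOf_sub_mem_mem_nhds x (hU (k + 1)).1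
  · rintro y ⟨hy, hyC⟩
    -- Differences of elements of `B k` lie in its double, hence one step further in the basis.
    have h1 : y - x ∈ B (k + 1) :=
      hB.two_smul_subset k ((hB.absConvex k).sub_mem_two_smul (hk hyC) (hk hx))
    simpa using hUs _ (hB.inter_subset_mixedNhd hU (k + 1) ⟨hy, h1⟩)

theorem isCompact_mixedTopology (hτ' : IsLCHS 𝕜 τ') {C : Set X} (hC : IsBddIn 𝕜 τ C)
    (hCc : @IsCompact X τ' C) : @IsCompact X (mixedTopology 𝕜 τ τ') C := by
  have := @IsCompact.image_of_continuousOn X X τ' (mixedTopology 𝕜 τ τ') C id hCc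
    (hB.continuousOn_id_mixedTopology hτ' hC)
  rwa [Set.image_id] at this

/-- Forward, the mixed topology is coarser than `τ'` on bounded sets. Backward, smallness near 0 on
each `B k`, with weight 2^(k+1), suffices by `mem_nhds_zero_mixedTopology`. -/
theorem continuous_mixedTopology_iff (hτ' : IsLCHS 𝕜 τ') (f : X →ₗ[𝕜] 𝕜) :
    @Continuous X 𝕜 (mixedTopology 𝕜 τ τ') _ f ↔
      ∀ C : Set X, IsBddIn 𝕜 τ C → @ContinuousOn X 𝕜 τ' _ f C := by
  constructor
  · intro hf C hC
    exact @Continuous.comp_continuousOn X X 𝕜 τ' (mixedTopology 𝕜 τ τ') _ f id C hf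
      (hB.continuousOn_id_mixedTopology hτ' hC)
  · intro hf
    have hgrp := hB.isTopologicalAddGroup_mixedTopology hτ'
    refine continuous_of_preimage_closedBall_mem_nhds hgrp f fun ε hε => ?_
    have hP : AbsConvex 𝕜 (f ⁻¹' Metric.closedBall 0 ε) :=
      AbsConvex.preimage_linearMap ⟨balanced_closedBall_zero,
        convex_RCLike_iff_convex_real.2 (convex_closedBall 0 ε)⟩ f
    refine hB.mem_nhds_zero_mixedTopology hτ' hP fun k => ?_
    have h1 := hf (B k) (hB.bounded k) 0 (hB.zero_mem k)
    have h2 : (0 : ℝ) < 2 ^ (k + 1) := by positivity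
    have h3 : Metric.closedBall (0 : 𝕜) (ε / 2 ^ (k + 1)) ∈ 𝓝 (f 0) := by
      rw [map_zero]
      exact Metric.closedBall_mem_nhds _ (div_pos hε h2)
    obtain ⟨U, hU, hUB⟩ := (@mem_nhdsWithin_iff_exists_mem_nhds_inter X τ' _ _ _).1 (h1 h3)
    refine ⟨U, hU, fun x hx => ?_⟩
    have h4 : f x ∈ Metric.closedBall (0 : 𝕜) (ε / 2 ^ (k + 1)) := hUB hx
    rw [mem_closedBall_zero_iff, le_div_iff₀ h2, mul_comm] at h4
    rw [Set.mem_preimage, mem_closedBall_zero_iff, map_smul, norm_smul, norm_pow,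
      RCLike.norm_ofNat]
    exact h4

theorem isBddIn_mixedTopology (hle : τ ≤ τ') (hτ' : IsLCHS 𝕜 τ') {C : Set X}
    (hC : IsBddIn 𝕜 τ C) : IsBddIn 𝕜 (mixedTopology 𝕜 τ τ') C := by
  obtain ⟨k, hk⟩ := hB.basis C hC
  refine isBddIn_of_hasBasis (hB.hasBasis_nhds_zero_mixedTopology hτ') fun U hU => ?_
  obtain ⟨r, hr, hrU⟩ := (absorbs_iff_exists_real (hU k).2.1).1 (hC (nhds_mono hle (hU k).1))
  have hr0 : (r : 𝕜) ≠ 0 := by exact_mod_cast hr.ne'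
  have hs : 0 < min r 1 := lt_min hr one_pos
  refine (absorbs_iff_exists_real (hB.absConvex_mixedNhd hU).1).2
    ⟨min r 1, hs, fun x hx => hB.inter_subset_mixedNhd hU k ⟨?_, ?_⟩⟩
  · have := (hU k).2.smul_mem_of_norm_le (c := ((min r 1 : ℝ) : 𝕜) * (r : 𝕜)⁻¹) (by
      rw [norm_mul, norm_inv, RCLike.norm_ofReal, RCLike.norm_ofReal, abs_of_pos hr,
        abs_of_pos hs, ← div_eq_mul_inv]
      exact (div_le_one hr).2 (min_le_left _ _)) (hrU x hx)
    simpa only [smul_smul, mul_assoc, inv_mul_cancel₀ hr0, mul_one] using this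
  · refine (hB.absConvex k).smul_mem_of_norm_le ?_ (hk hx)
    rw [RCLike.norm_ofReal, abs_of_pos hs]
    exact min_le_right _ _

/-- Under (CNC) the mixed topology has the same bounded sets as the given one. -/
theorem sameBounded_mixedTopology (hle : τ ≤ τ') (hτ' : IsLCHS 𝕜 τ') (h : CNC 𝕜 τ τ') :
    SameBounded 𝕜 τ (mixedTopology 𝕜 τ τ') := by
  refine fun A => ⟨hB.isBddIn_mixedTopology hle hτ', fun hA U hU => ?_⟩
  obtain ⟨V, hV, hVU, hVa, hVc⟩ := h U hU
  refine Absorbs.mono_left ?_ hVU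
  by_contra hcon
  rw [absorbs_iff_exists_real hVa.1] at hcon
  push Not at hcon
  -- The quadratic rate leaves room for the factor 1/(n+1) in g: the g n tend to 0 uniformly on
  -- bounded sets, yet exceed n + 1 in norm at x n, so the polar of all g n cannot absorb A.
  choose x hxA hxV using fun n : ℕ => hcon (((n : ℝ) + 1) ^ 2)⁻¹ (by positivity)
  choose f hf hfV hfx using fun n =>
    hτ'.exists_dual_norm_le_one hVa hVc ⟨0, @mem_of_mem_nhds X τ 0 _ hV⟩ (hxV n)
  let g : ℕ → X →ₗ[𝕜] 𝕜 := fun n => ((n : 𝕜) + 1)⁻¹ • f n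
  have hn1 : ∀ n : ℕ, ‖((n : 𝕜) + 1)⁻¹‖ = ((n : ℝ) + 1)⁻¹ := fun n => by
    rw [norm_inv]
    congr 1
    exact_mod_cast RCLike.norm_natCast (K := 𝕜) (n + 1)
  have hg : ∀ n x, ‖g n x‖ = ((n : ℝ) + 1)⁻¹ * ‖f n x‖ := fun n x => by
    rw [LinearMap.smul_apply, norm_smul, hn1]
  have hP : AbsConvex 𝕜 {x | ∀ n ∈ (Set.univ : Set ℕ), ‖g n x‖ ≤ 1} := absConvex_polar _ g
  have hPn : {x | ∀ n ∈ (Set.univ : Set ℕ), ‖g n x‖ ≤ 1} ∈ @nhds X (mixedTopology 𝕜 τ τ') 0 := by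
    refine hB.mem_nhds_zero_mixedTopology hτ' hP fun k => ?_
    obtain ⟨r, hr, hrV⟩ := (absorbs_iff_exists_real hVa.1).1 (hB.bounded k hV)
    obtain ⟨N, hN⟩ := exists_nat_ge (2 ^ (k + 1) * r⁻¹)
    -- On B k the conditions for n ≥ N hold automatically, so only finitely many `τ'`-continuous
    -- functionals need to be small.
    refine ⟨⋂ n ∈ Finset.range N, {x | ‖g n ((2 : 𝕜) ^ (k + 1) • x)‖ ≤ 1}, ?_, ?_⟩
    · refine (Filter.biInter_finset_mem _).2 fun n _ => ?_
      exact setOf_norm_smul_apply_smul_le_one_mem_nhds (hf n) _ _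
    · rintro x ⟨hxU, hxB⟩ n -
      by_cases hn : n < N
      · exact Set.mem_iInter₂.1 hxU n (Finset.mem_range.2 hn)
      · have h1 := exists_norm_le_of_polar hr (fun y hy => hfV n _ (hrV y hy)) x hxB
        rw [hg, map_smul, norm_smul, norm_pow, RCLike.norm_ofNat, ← div_eq_inv_mul,
          div_le_one (by positivity)]
        have h2 : (N : ℝ) ≤ n := by exact_mod_cast not_lt.1 hn
        calc 2 ^ (k + 1) * ‖f n x‖ ≤ 2 ^ (k + 1) * r⁻¹ := by gcongr
          _ ≤ (n : ℝ) + 1 := by linarith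
  obtain ⟨r, hr, hrP⟩ := (absorbs_iff_exists_real hP.1).1 (hA hPn)
  obtain ⟨n, hn⟩ := exists_nat_ge r⁻¹
  have h1 := hrP (x n) (hxA n) n (Set.mem_univ n)
  have h2 := hfx n
  have h3 : (0 : ℝ) < (n : ℝ) + 1 := by positivity
  rw [hg, map_smul, norm_smul, RCLike.norm_ofReal, abs_of_pos hr, ← div_eq_inv_mul,
    div_le_one h3] at h1
  rw [map_smul, norm_smul, RCLike.norm_ofReal, abs_of_pos (by positivity), ← div_eq_inv_mul,
    one_lt_div (by positivity)] at h2
  have h4 : 1 ≤ r * ((n : ℝ) + 1) := by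
    calc (1 : ℝ) = r * r⁻¹ := (mul_inv_cancel₀ hr.ne').symm
      _ ≤ r * ((n : ℝ) + 1) := by gcongr; linarith
  nlinarith

end IsMixedBasis

/-- The strong dual for the mixed topology is a candidate predual. -/
theorem isCandidatePairing_strongDual {τ τ' : TopologicalSpace X} [γ : TopologicalSpace X]
    (hγ : SameBounded 𝕜 τ γ)
    (hc : ∀ f : X →ₗ[𝕜] 𝕜, @Continuous X 𝕜 γ _ f ↔
      ∀ C : Set X, IsBddIn 𝕜 τ C → @ContinuousOn X 𝕜 τ' _ f C) :
    IsCandidatePairing (V := X →L[𝕜] 𝕜) τ τ' (ContinuousLinearMap.coeLM 𝕜) where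
  injective := ContinuousLinearMap.coe_injective
  continuousOn v := (hc v).1 v.continuous
  exists_eq f hf := ⟨⟨f, (hc f).2 hf⟩, rfl⟩
  isInducing := by
    have h : {B : Set X | IsBddIn 𝕜 τ B} = {B : Set X | IsVonNBounded 𝕜 B} := Set.ext hγ
    rw [h]
    exact (UniformConvergenceCLM.isEmbedding_coeFn (RingHom.id 𝕜) 𝕜
      {B : Set X | IsVonNBounded 𝕜 B}).isInducing

end MixedTopology

/-! ### Fréchet preduals and their weak-star topology. -/

section FrechetPredual

variable {𝕜 : Type} [RCLike 𝕜] {X Y : Type u} [AddCommGroup X] [Module 𝕜 X]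
  [AddCommGroup Y] [Module 𝕜 Y]

theorem setOf_norm_le_one_mem_nhds_of_bornological {τ : TopologicalSpace X}
    (hborn : IsBornologicalTVS 𝕜 τ) {H : Set (X →L[𝕜] 𝕜)} (hH : IsVonNBounded 𝕜 H) :
    {x | ∀ f ∈ H, ‖f x‖ ≤ 1} ∈ 𝓝 (0 : X) := by
  have habs : AbsConvex 𝕜 {x | ∀ f ∈ H, ‖f x‖ ≤ 1} :=
    absConvex_polar H fun f : X →L[𝕜] 𝕜 => f.toLinearMap
  refine hborn _ habs fun B hB => ?_
  obtain ⟨C, hC⟩ := isVonNBounded_strongDual_iff.1 hH B hB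
  have h1 : 0 < max C 1 := lt_max_of_lt_right one_pos
  refine (absorbs_iff_exists_real habs.1).2 ⟨(max C 1)⁻¹, inv_pos.2 h1, fun x hx f hf => ?_⟩
  rw [map_smul, norm_smul, RCLike.norm_ofReal, abs_of_pos (inv_pos.2 h1), ← div_eq_inv_mul,
    div_le_one h1]
  exact (hC f hf x hx).trans (le_max_left _ _)

theorem equicontinuous_of_setOf_norm_le_one_mem_nhds {τ : TopologicalSpace X}
    (hτ : IsLCHS 𝕜 τ) {H : Set (X →L[𝕜] 𝕜)} (hH : {x | ∀ f ∈ H, ‖f x‖ ≤ 1} ∈ 𝓝 (0 : X)) :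
    Equicontinuous (fun (f : H) (x : X) => (f : X →L[𝕜] 𝕜) x) := by
  have := hτ.topologicalAddGroup
  have := hτ.continuousSMul
  refine equicontinuous_of_equicontinuousAt_zero (fun f : H => (f : X →L[𝕜] 𝕜)) ?_
  rw [Metric.equicontinuousAt_iff_right]
  intro ε hε
  have hε2 : 0 < ε / 2 := half_pos hε
  have hε0 : ((ε / 2 : ℝ) : 𝕜) ≠ 0 := by exact_mod_cast hε2.ne'
  filter_upwards [(set_smul_mem_nhds_zero_iff hε0).2 hH] with x hx f
  obtain ⟨y, hy, rfl⟩ := hx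
  simp only [Function.comp_apply, map_zero, dist_zero_left]
  rw [map_smul, norm_smul, RCLike.norm_ofReal, abs_of_pos hε2]
  have := hy f f.2
  nlinarith

/-- The polar of a strongly bounded set absorbs all bounded sets, so on a bornological space every
such set is equicontinuous, countable union or not. -/
theorem IsLCHS.isDF_of_bornological {τ : TopologicalSpace X} (hτ : IsLCHS 𝕜 τ)
    (hborn : IsBornologicalTVS 𝕜 τ) (h : ∃ B : ℕ → Set X, (∀ n, IsBddIn 𝕜 τ (B n)) ∧
      ∀ C : Set X, IsBddIn 𝕜 τ C → ∃ n, C ⊆ B n) : IsDF 𝕜 τ :=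
  ⟨hτ, h, fun _ _ hH => equicontinuous_of_setOf_norm_le_one_mem_nhds hτ
    (setOf_norm_le_one_mem_nhds_of_bornological hborn hH)⟩

theorem IsFrechet.barrelledSpace {t : TopologicalSpace Y} (ht : IsFrechet 𝕜 t) :
    BarrelledSpace 𝕜 Y := by
  have := ht.lchs.topologicalAddGroup
  have := ht.lchs.continuousSMul
  have := ht.metrizable
  let u : UniformSpace Y := IsTopologicalAddGroup.rightUniformSpace Y
  have : IsUniformAddGroup Y := isUniformAddGroup_of_addCommGroup
  obtain ⟨_, hc⟩ := ht.complete
  have hc' : CompleteSpace Y := hc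
  have : Filter.IsCountablyGenerated (uniformity Y) :=
    IsUniformAddGroup.uniformity_countably_generated
  infer_instance

theorem IsFrechet.completeSpace_strongDual {t : TopologicalSpace Y} (ht : IsFrechet 𝕜 t) :
    CompleteSpace (Y →L[𝕜] 𝕜) := by
  have := ht.lchs.topologicalAddGroup
  have := ht.lchs.continuousSMul
  have := ht.metrizable
  infer_instance

theorem isCompleteTVS_of_continuousLinearEquiv {τ : TopologicalSpace X} (hτ : IsLCHS 𝕜 τ)
    {F : Type*} [AddCommGroup F] [Module 𝕜 F] [UniformSpace F] [IsUniformAddGroup F]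
    [CompleteSpace F] (e : X ≃L[𝕜] F) : IsCompleteTVS τ := by
  have := hτ.topologicalAddGroup
  let u : UniformSpace X := IsTopologicalAddGroup.rightUniformSpace X
  have : IsUniformAddGroup X := isUniformAddGroup_of_addCommGroup
  exact ⟨hτ.topologicalAddGroup,
    (completeSpace_congr (e := e.toEquiv) e.isUniformEmbedding).2 inferInstance⟩

/-- Polars of neighbourhoods are strongly bounded; conversely, Banach-Steinhaus on Y puts each
bounded set of functionals into the polar of a member of a countable basis. -/
theorem exists_bounded_basis_of_predual {τ : TopologicalSpace X} {t : TopologicalSpace Y}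
    (ht : IsFrechet 𝕜 t) (e : X ≃L[𝕜] (Y →L[𝕜] 𝕜)) :
    ∃ U : ℕ → Set Y, (∀ n, U n ∈ 𝓝 (0 : Y)) ∧
      (∀ n, IsBddIn 𝕜 τ {x | ∀ y ∈ U n, ‖e x y‖ ≤ 1}) ∧
      ∀ C : Set X, IsBddIn 𝕜 τ C → ∃ n, C ⊆ {x | ∀ y ∈ U n, ‖e x y‖ ≤ 1} := by
  have := ht.lchs.topologicalAddGroup
  have := ht.lchs.continuousSMul
  have := ht.lchs.locallyConvex
  have := ht.metrizable
  have := ht.barrelledSpace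
  obtain ⟨U, hU, hUa⟩ := exists_nhds_hasAntitoneBasis_absConvex_open_add_closure_subset 𝕜 Y
  refine ⟨U, fun n => hU.1.mem_of_mem trivial, fun n => ?_, fun C hC => ?_⟩
  · have hb : IsVonNBounded 𝕜 {f : Y →L[𝕜] 𝕜 | ∀ y ∈ U n, ‖f y‖ ≤ 1} := by
      refine isVonNBounded_strongDual_iff.2 fun S hS => ?_
      obtain ⟨r, hr, h⟩ := exists_real_smul_mem_of_isVonNBounded hS
        (hU.1.mem_of_mem (i := n) trivial) (hUa n).2.1.1
      exact ⟨r⁻¹, fun f hf => exists_norm_le_of_polar (f := f.toLinearMap) hr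
        fun y hy => hf _ (h y hy)⟩
    refine IsVonNBounded.subset ?_ (hb.image e.symm.toContinuousLinearMap)
    exact fun x hx => ⟨e x, hx, by simp⟩
  · have hb : IsVonNBounded 𝕜 (e '' C) := IsVonNBounded.image hC e.toContinuousLinearMap
    have hpt : ∀ y, ∃ M : ℝ, ∀ f ∈ e '' C, ‖f y‖ ≤ M := fun y => by
      obtain ⟨M, hM⟩ := isVonNBounded_strongDual_iff.1 hb {y} (isVonNBounded_singleton y)
      exact ⟨M, fun f hf => hM f hf y rfl⟩
    obtain ⟨n, -, hn⟩ := hU.1.mem_iff.1 (setOf_norm_le_one_mem_nhds_of_barrelled hpt)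
    exact ⟨n, fun x hx y hy => hn hy (e x) ⟨x, hx, rfl⟩⟩

/-- The evaluations at the points of the predual, as a map into a product. -/
def predualEval {τ : TopologicalSpace X} {t : TopologicalSpace Y} (e : X ≃L[𝕜] (Y →L[𝕜] 𝕜)) :
    X →ₗ[𝕜] (Y → 𝕜) where
  toFun x y := e x y
  map_add' x y := by ext; simp
  map_smul' c x := by ext; simp

/-- The topology of pointwise convergence on a predual. -/
@[reducible] def predualTopology {τ : TopologicalSpace X} {t : TopologicalSpace Y}
    (e : X ≃L[𝕜] (Y →L[𝕜] 𝕜)) : TopologicalSpace X :=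
  TopologicalSpace.induced (predualEval e) inferInstance

theorem isLCHS_predualTopology {τ : TopologicalSpace X} {t : TopologicalSpace Y}
    (e : X ≃L[𝕜] (Y →L[𝕜] 𝕜)) : IsLCHS 𝕜 (predualTopology e) where
  topologicalAddGroup := topologicalAddGroup_induced (predualEval e)
  continuousSMul := continuousSMul_induced (predualEval e)
  locallyConvex := LocallyConvexSpace.induced (predualEval e)
  t2 := by
    have hinj : Function.Injective (predualEval e) := fun x y hxy =>
      e.injective (ContinuousLinearMap.ext fun v => congrFun hxy v)
    exact @IsEmbedding.t2Space X (Y → 𝕜) (predualTopology e) _ _ _ (hinj.isEmbedding_induced)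

theorem absConvex_predualPolar {τ : TopologicalSpace X} {t : TopologicalSpace Y}
    (e : X ≃L[𝕜] (Y →L[𝕜] 𝕜)) (S : Set Y) : AbsConvex 𝕜 {x | ∀ y ∈ S, ‖e x y‖ ≤ 1} :=
  absConvex_polar S fun y : Y => (LinearMap.proj y).comp (predualEval e)

theorem isClosed_predualPolar {τ : TopologicalSpace X} {t : TopologicalSpace Y}
    (e : X ≃L[𝕜] (Y →L[𝕜] 𝕜)) (S : Set Y) :
    IsClosed[predualTopology e] {x | ∀ y ∈ S, ‖e x y‖ ≤ 1} := by
  have h : IsClosed {g : Y → 𝕜 | ∀ y ∈ S, ‖g y‖ ≤ 1} := by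
    simp only [Set.ofPred_forall]
    exact isClosed_biInter fun y _ => isClosed_le (by fun_prop) continuous_const
  exact isClosed_induced_iff.2 ⟨_, h, rfl⟩

/-- The polars of neighbourhoods of zero are compact for pointwise convergence. -/
theorem isCompact_predualPolar {τ : TopologicalSpace X} {t : TopologicalSpace Y}
    (ht : IsLCHS 𝕜 t) (e : X ≃L[𝕜] (Y →L[𝕜] 𝕜)) {U : Set Y} (hU : U ∈ 𝓝 (0 : Y)) :
    @IsCompact X (predualTopology e) {x | ∀ y ∈ U, ‖e x y‖ ≤ 1} := by
  have := ht.topologicalAddGroup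
  have := ht.continuousSMul
  have hind : @IsInducing X (Y → 𝕜) (predualTopology e) _ (predualEval e) :=
    @IsInducing.mk X (Y → 𝕜) (predualTopology e) _ _ rfl
  rw [@IsInducing.isCompact_iff X (Y → 𝕜) (predualTopology e) _ _ (predualEval e) hind]
  -- A linear functional bounded on U is automatically continuous, so the image is cut out by
  -- pointwise closed conditions.
  have him : predualEval e '' {x | ∀ y ∈ U, ‖e x y‖ ≤ 1} =
      Set.range ((↑) : (Y →ₗ[𝕜] 𝕜) → Y → 𝕜) ∩ {g | ∀ y ∈ U, ‖g y‖ ≤ 1} := by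
    ext g
    constructor
    · rintro ⟨x, hx, rfl⟩
      exact ⟨⟨e x, rfl⟩, hx⟩
    · rintro ⟨⟨f, rfl⟩, hf⟩
      have hc : Continuous f := (f.clmOfExistsBoundedImage ⟨U, hU,
        (NormedSpace.isVonNBounded_iff' 𝕜).2 ⟨1, Set.forall_mem_image.2 hf⟩⟩).continuous
      refine ⟨e.symm ⟨f, hc⟩, fun y hy => ?_, ?_⟩
      · rw [e.apply_symm_apply]
        exact hf y hy
      · funext y
        change e (e.symm ⟨f, hc⟩) y = f y
        rw [e.apply_symm_apply]
        rfl
  rw [him]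
  -- A nonzero multiple of y in U bounds the value at y, placing the image in a product of compact
  -- balls.
  have hr : ∀ y : Y, ∃ c : 𝕜, c ≠ 0 ∧ c • y ∈ U := fun y => by
    have h1 : Filter.Tendsto (fun c : 𝕜 => c • y) (𝓝[≠] 0) (𝓝 0) := by
      have : Filter.Tendsto (fun c : 𝕜 => c • y) (𝓝 0) (𝓝 ((0 : 𝕜) • y)) :=
        (continuous_id.smul continuous_const).tendsto 0
      rw [zero_smul] at this
      exact this.mono_left nhdsWithin_le_nhds
    exact ((eventually_mem_nhdsWithin (s := {(0 : 𝕜)}ᶜ)).and (h1 hU)).exists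
  choose c hc0 hcU using hr
  refine (isCompact_univ_pi fun y => isCompact_closedBall (0 : 𝕜) ‖c y‖⁻¹).of_isClosed_subset
    ?_ ?_
  · refine (LinearMap.isClosed_range_coe Y 𝕜 (RingHom.id 𝕜)).inter ?_
    simp only [Set.ofPred_forall]
    exact isClosed_biInter fun y _ => isClosed_le (by fun_prop) continuous_const
  · rintro _ ⟨⟨f, rfl⟩, hf⟩ y -
    have h2 := hf _ (hcU y)
    rw [map_smul, norm_smul] at h2
    rw [mem_closedBall_zero_iff, ← one_div, le_div_iff₀' (norm_pos_iff.2 (hc0 y))]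
    exact h2

theorem bbc_predualTopology {τ : TopologicalSpace X} {t : TopologicalSpace Y}
    (ht : IsFrechet 𝕜 t) (e : X ≃L[𝕜] (Y →L[𝕜] 𝕜)) : BBC 𝕜 τ (predualTopology e) := by
  obtain ⟨U, hU, hUb, hUC⟩ := exists_bounded_basis_of_predual ht e
  intro B hB
  obtain ⟨n, hn⟩ := hUC B hB
  exact ⟨_, hn, absConvex_predualPolar e (U n), hUb n, isCompact_predualPolar ht.lchs e (hU n)⟩

/-- Through e, polars of bounded subsets of Y form a basis at zero, and they are closed for
pointwise convergence. -/
theorem cnc_predualTopology {τ : TopologicalSpace X} {t : TopologicalSpace Y}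
    (ht : IsLCHS 𝕜 t) (e : X ≃L[𝕜] (Y →L[𝕜] 𝕜)) : CNC 𝕜 τ (predualTopology e) := by
  have := ht.continuousSMul
  intro U hU
  have h1 := e.symm.continuous.tendsto 0
  rw [map_zero] at h1
  obtain ⟨S, hS, hSU⟩ := strongDual_hasBasis.mem_iff.1 (h1 hU)
  refine ⟨{x | ∀ y ∈ S, ‖e x y‖ ≤ 1}, ?_, ?_, absConvex_predualPolar e S,
    isClosed_predualPolar e S⟩
  · have h2 := e.continuous.tendsto 0
    rw [map_zero] at h2
    exact h2 (strongDual_hasBasis.mem_of_mem hS)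
  · intro x hx
    have := hSU hx
    simpa using this

end FrechetPredual

/-! ### The implications between the six conditions. -/

section Equivalences

variable {𝕜 : Type} [RCLike 𝕜] {X : Type u} [AddCommGroup X] [Module 𝕜 X]
  {τ' τ : TopologicalSpace X}

theorem HasFrechetPredual.of_prebidual (h : HasSemiMontelPrebidualWithFrechetDual 𝕜 τ) :
    HasFrechetPredual 𝕜 τ := by
  obtain ⟨Y, _, _, t, -, -, hF, he⟩ := h
  exact ⟨Y →L[𝕜] 𝕜, _, _, _, hF, he⟩

theorem HasFrechetPredual.exists_bbc_cnc (hτ : IsLCHS 𝕜 τ) (hborn : IsBornologicalTVS 𝕜 τ)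
    (h : HasFrechetPredual 𝕜 τ) : IsCompleteTVS τ ∧ IsDF 𝕜 τ ∧
      ∃ τ' : TopologicalSpace X, IsLCHS 𝕜 τ' ∧ BBC 𝕜 τ τ' ∧ CNC 𝕜 τ τ' := by
  obtain ⟨Y, _, _, t, ht, ⟨e⟩⟩ := h
  refine ⟨?_, ?_, predualTopology e, isLCHS_predualTopology e, bbc_predualTopology ht e,
    cnc_predualTopology ht.lchs e⟩
  · have := ht.lchs.continuousSMul
    have := ht.completeSpace_strongDual
    exact isCompleteTVS_of_continuousLinearEquiv hτ e
  · obtain ⟨U, -, hU, hUC⟩ := exists_bounded_basis_of_predual ht e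
    exact hτ.isDF_of_bornological hborn ⟨_, hU, hUC⟩

theorem isSemiReflexive_mixedTopology (hτ : IsLCHS 𝕜 τ) (hborn : IsBornologicalTVS 𝕜 τ)
    (hDF : IsDF 𝕜 τ) (hτ' : IsLCHS 𝕜 τ') (h : BBC 𝕜 τ τ') (hc : CNC 𝕜 τ τ') :
    IsSemiReflexive 𝕜 (mixedTopology 𝕜 τ τ') := by
  obtain ⟨B, hB⟩ := exists_mixedBasis hDF (h.toBBCl hτ')
  have hp := @isCandidatePairing_strongDual 𝕜 _ X _ _ τ τ' (mixedTopology 𝕜 τ τ')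
    (hB.sameBounded_mixedTopology (h.le hτ hborn hτ') hτ' hc) (hB.continuous_mixedTopology_iff hτ')
  intro f
  obtain ⟨x, rfl⟩ := hp.eval_surjective hτ h f
  exact ⟨x, fun _ => rfl⟩

/-- Semi-reflexivity replaces compactness as the source of surjectivity, so (BBCl) is enough here.
-/
theorem hasFrechetPredual_of_isSemiReflexive (hτ : IsLCHS 𝕜 τ) (hborn : IsBornologicalTVS 𝕜 τ)
    (hDF : IsDF 𝕜 τ) (hτ' : IsLCHS 𝕜 τ') (hle : τ ≤ τ') (h : BBCl 𝕜 τ τ') (hc : CNC 𝕜 τ τ')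
    (hs : IsSemiReflexive 𝕜 (mixedTopology 𝕜 τ τ')) : HasFrechetPredual 𝕜 τ := by
  obtain ⟨B, hB⟩ := exists_mixedBasis hDF h
  have hp := @isCandidatePairing_strongDual 𝕜 _ X _ _ τ τ' (mixedTopology 𝕜 τ τ')
    (hB.sameBounded_mixedTopology hle hτ' hc) (hB.continuous_mixedTopology_iff hτ')
  have hF := hp.isFrechet hτ hle h hτ' hB
  obtain ⟨e, -⟩ := hp.exists_continuousLinearEquiv hτ hborn hτ' hF.lchs
    (fun f => by
      obtain ⟨x, hx⟩ := hs f
      exact ⟨x, ContinuousLinearMap.ext fun v => (hx v).symm⟩)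
    (fun U hU => hp.exists_nhds_preimage_eval_subset hτ hτ' hc hF.lchs hU)
  exact ⟨_, _, _, _, hF, ⟨e⟩⟩

theorem isSemiMontel_mixedTopology {B : ℕ → Set X} (hB : IsMixedBasis 𝕜 τ τ' B)
    (hτ : IsLCHS 𝕜 τ) (hle : τ ≤ τ') (hτ' : IsLCHS 𝕜 τ') (h : BBC 𝕜 τ τ') (hc : CNC 𝕜 τ τ') :
    IsSemiMontel 𝕜 (mixedTopology 𝕜 τ τ') := by
  intro S hS
  obtain ⟨C, hSC, -, hCb, hC⟩ := h S ((hB.sameBounded_mixedTopology hle hτ' hc S).2 hS)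
  have hR : @R1Space X (mixedTopology 𝕜 τ τ') :=
    @T2Space.r1Space X (mixedTopology 𝕜 τ τ') (hB.isLCHS_mixedTopology hτ hτ').t2
  exact @IsCompact.closure_of_subset X (mixedTopology 𝕜 τ τ') hR S C
    (hB.isCompact_mixedTopology hτ' hCb hC) hSC

theorem hasSemiMontelPrebidual_of_bbc_cnc (hτ : IsLCHS 𝕜 τ) (hborn : IsBornologicalTVS 𝕜 τ)
    (hDF : IsDF 𝕜 τ) (hτ' : IsLCHS 𝕜 τ') (h : BBC 𝕜 τ τ') (hc : CNC 𝕜 τ τ') :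
    HasSemiMontelPrebidualWithFrechetDual 𝕜 τ := by
  have hle := h.le hτ hborn hτ'
  obtain ⟨B, hB⟩ := exists_mixedBasis hDF (h.toBBCl hτ')
  have hp := @isCandidatePairing_strongDual 𝕜 _ X _ _ τ τ' (mixedTopology 𝕜 τ τ')
    (hB.sameBounded_mixedTopology hle hτ' hc) (hB.continuous_mixedTopology_iff hτ')
  have hF := hp.isFrechet hτ hle (h.toBBCl hτ') hτ' hB
  obtain ⟨e, -⟩ := hp.exists_continuousLinearEquiv hτ hborn hτ' hF.lchs
    (hp.eval_surjective hτ h)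
    (fun U hU => hp.exists_nhds_preimage_eval_subset hτ hτ' hc hF.lchs hU)
  exact ⟨X, _, _, mixedTopology 𝕜 τ τ', hB.isLCHS_mixedTopology hτ hτ',
    isSemiMontel_mixedTopology hB hτ hle hτ' h hc, hF, ⟨e⟩⟩

theorem IsCandidatePairing.hasFrechetPredual_of_isDistinguished {V : Type u} [AddCommGroup V]
    [Module 𝕜 V] [tV : TopologicalSpace V] {p : V →ₗ[𝕜] X →ₗ[𝕜] 𝕜}
    (hp : IsCandidatePairing τ τ' p) (hτ : IsLCHS 𝕜 τ) (hborn : IsBornologicalTVS 𝕜 τ)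
    (hDF : IsDF 𝕜 τ) (hτ' : IsLCHS 𝕜 τ') (h : BBC 𝕜 τ τ') (hd : IsDistinguished 𝕜 tV) :
    HasFrechetPredual 𝕜 τ := by
  have hle := h.le hτ hborn hτ'
  obtain ⟨B, hB, hBc⟩ := exists_mixedBasis_isCompact hDF hτ' h
  have hF := hp.isFrechet hτ hle (h.toBBCl hτ') hτ' hB
  have hs := hp.eval_surjective hτ h
  have : BarrelledSpace 𝕜 (V →L[𝕜] 𝕜) := hd
  obtain ⟨e, -⟩ := hp.exists_continuousLinearEquiv hτ hborn hτ' hF.lchs hs fun U hU =>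
    hp.exists_nhds_preimage_eval_subset_of_barrelled hτ hτ' hle (h.toBBCl hτ') hs hB hBc hU
  exact ⟨_, _, _, _, hF, ⟨e⟩⟩

attribute [local instance] candidateTopology

theorem isFrechet_candidateTopology (hτ : IsLCHS 𝕜 τ) (hborn : IsBornologicalTVS 𝕜 τ)
    (hDF : IsDF 𝕜 τ) (hτ' : IsLCHS 𝕜 τ') (h : BBC 𝕜 τ τ') :
    IsFrechet 𝕜 (candidateTopology 𝕜 τ τ') := by
  obtain ⟨B, hB⟩ := exists_mixedBasis hDF (h.toBBCl hτ')
  exact (isCandidatePairing_candidatePairing τ τ').isFrechet hτ (h.le hτ hborn hτ')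
    (h.toBBCl hτ') hτ' hB

theorem isDistinguished_candidateTopology (hτ : IsLCHS 𝕜 τ) (hborn : IsBornologicalTVS 𝕜 τ)
    (hDF : IsDF 𝕜 τ) (hτ' : IsLCHS 𝕜 τ') (h : BBC 𝕜 τ τ') (hc : CNC 𝕜 τ τ') :
    IsDistinguished 𝕜 (candidateTopology 𝕜 τ τ') := by
  have hF := isFrechet_candidateTopology hτ hborn hDF hτ' h
  have hp := isCandidatePairing_candidatePairing (𝕜 := 𝕜) τ τ'
  obtain ⟨e, he⟩ := hp.exists_continuousLinearEquiv hτ hborn hτ' hF.lchs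
    (hp.eval_surjective hτ h)
    (fun U hU => hp.exists_nhds_preimage_eval_subset hτ hτ' hc hF.lchs hU)
  exact hp.barrelledSpace_strongDual hτ hborn hF.lchs e he

theorem hasFrechetPredual_of_isDistinguished (hτ : IsLCHS 𝕜 τ) (hborn : IsBornologicalTVS 𝕜 τ)
    (hDF : IsDF 𝕜 τ) (hτ' : IsLCHS 𝕜 τ') (h : BBC 𝕜 τ τ')
    (hd : IsDistinguished 𝕜 (candidateTopology 𝕜 τ τ')) : HasFrechetPredual 𝕜 τ :=
  (isCandidatePairing_candidatePairing τ τ').hasFrechetPredual_of_isDistinguished hτ hborn hDF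
    hτ' h hd

end Equivalences

theorem mainTheorem4 {𝕜 : Type} [RCLike 𝕜] {X : Type u} [AddCommGroup X] [Module 𝕜 X]
    (τ : TopologicalSpace X) (hτ : IsLCHS 𝕜 τ) (hborn : IsBornologicalTVS 𝕜 τ) :
    List.TFAE [
      -- (a)
      HasFrechetPredual 𝕜 τ,
      -- (b)
      HasSemiMontelPrebidualWithFrechetDual 𝕜 τ,
      -- (c)
      IsCompleteTVS τ ∧ IsDF 𝕜 τ ∧
        ∃ τ' : TopologicalSpace X, IsLCHS 𝕜 τ' ∧ BBC 𝕜 τ τ' ∧ CNC 𝕜 τ τ' ∧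
          SameBounded 𝕜 τ (mixedTopology 𝕜 τ τ'),
      -- (d), where `τ ≤ τ'` means in Mathlib that `τ'` is coarser than `τ`
      IsCompleteTVS τ ∧ IsDF 𝕜 τ ∧
        ∃ τ' : TopologicalSpace X, IsLCHS 𝕜 τ' ∧ τ ≤ τ' ∧ BBCl 𝕜 τ τ' ∧ CNC 𝕜 τ τ' ∧
          IsSemiReflexive 𝕜 (mixedTopology 𝕜 τ τ'),
      -- (e)
      IsCompleteTVS τ ∧ IsDF 𝕜 τ ∧
        ∃ τ' : TopologicalSpace X, IsLCHS 𝕜 τ' ∧ BBC 𝕜 τ τ' ∧ CNC 𝕜 τ τ',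
      -- (f)
      IsCompleteTVS τ ∧ IsDF 𝕜 τ ∧
        ∃ τ' : TopologicalSpace X, IsLCHS 𝕜 τ' ∧ BBC 𝕜 τ τ' ∧
          IsDistinguished 𝕜 (candidateTopology 𝕜 τ τ')] ∧
    -- the candidate predual in (f) is indeed a Fréchet space
    (IsCompleteTVS τ → IsDF 𝕜 τ → ∀ τ' : TopologicalSpace X, IsLCHS 𝕜 τ' → BBC 𝕜 τ τ' →
      IsFrechet 𝕜 (candidateTopology 𝕜 τ τ')) := by
  refine ⟨?_, fun _ hDF τ' hτ' h => isFrechet_candidateTopology hτ hborn hDF hτ' h⟩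
  -- Condition (e) is the hub: (a) implies it, it implies all the others, and each of those leads
  -- back to (a) or (e).
  tfae_have 1 → 5 := fun h => h.exists_bbc_cnc hτ hborn
  tfae_have 2 → 1 := HasFrechetPredual.of_prebidual
  tfae_have 5 → 2 := fun ⟨_, hDF, _, hτ', h, hc⟩ =>
    hasSemiMontelPrebidual_of_bbc_cnc hτ hborn hDF hτ' h hc
  tfae_have 3 → 5 := fun ⟨hC, hDF, τ', hτ', h, hc, _⟩ => ⟨hC, hDF, τ', hτ', h, hc⟩
  tfae_have 5 → 3 := fun ⟨hC, hDF, τ', hτ', h, hc⟩ => by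
    obtain ⟨B, hB⟩ := exists_mixedBasis hDF (h.toBBCl hτ')
    exact ⟨hC, hDF, τ', hτ', h, hc,
      hB.sameBounded_mixedTopology (h.le hτ hborn hτ') hτ' hc⟩
  tfae_have 5 → 4 := fun ⟨hC, hDF, τ', hτ', h, hc⟩ => ⟨hC, hDF, τ', hτ', h.le hτ hborn hτ',
    h.toBBCl hτ', hc, isSemiReflexive_mixedTopology hτ hborn hDF hτ' h hc⟩
  tfae_have 4 → 1 := fun ⟨_, hDF, _, hτ', hle, h, hc, hs⟩ =>
    hasFrechetPredual_of_isSemiReflexive hτ hborn hDF hτ' hle h hc hs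
  tfae_have 5 → 6 := fun ⟨hC, hDF, τ', hτ', h, hc⟩ =>
    ⟨hC, hDF, τ', hτ', h, isDistinguished_candidateTopology hτ hborn hDF hτ' h hc⟩
  tfae_have 6 → 1 := fun ⟨_, hDF, _, hτ', h, hd⟩ =>
    hasFrechetPredual_of_isDistinguished hτ hborn hDF hτ' h hd
  tfae_finish
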